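/- **Setting.** Let $\mathcal C, S, A$ be finite sets (contexts, states, actions; $A\neq\emptyset$), $H,T\ge 1$ integers. $S$ is a disjoint union of layers $S_1=\{s_1\},S_2,\dots,S_H,S_{H+1}=\{s_{H+1}\}$, and every transition function considered below moves only from $S_h$ to $S_{h+1}$, $h\le H$. For each context $c$ there are a transition function $P^\star_c:S\times A\to\Delta_S$ and, for each $(s,a)$, a distribution of the observed loss on $[0,1]$, with mean $\ell^\star_c(s,a)$. Contexts are drawn i.i.d. from a distribution $\mathcal D$ on $\mathcal C$; $\mathbb E_c$ is the expectation over a fresh $c\sim\mathcal D$. For $\pi:S\to\Delta_A$, let $q_h(s,a\mid\pi,P)$ be the probability of being at $s$ and playing $a$ at step $h$ when $\pi$ is played from $s_1$ under $P$, and $V^{\pi}_c(s_1)=\mathbb E_{\pi,P^\star_c}[\sum_{h=1}^H\ell^\star_c(s_h,a_h)\mid s_1]$. Let $\mathcal F$ be a finite class of functions $\mathcal C\times S\times A\to[0,1]$ with $\ell^\star\in\mathcal F$, and $\mathcal P$ a finite class of (layer-respecting) functions $\mathcal C\times S\times A\to\Delta_S$ with $P^\star\in\mathcal P$. **Algorithm.**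 Fix $\eta\in\mathbb R$ and $\beta_\ell,\beta_P>0$. In round $t=1,\dots,T$ a context $c_t\sim\mathcal D$ is drawn and $\pi^t_{c_t}$ is played, producing a trajectory $(c_t,s^t_1,a^t_1,\ell^t_1,\dots,s^t_{H+1})$ in which, given the contexts, states and actions, the losses are independent with the distributions above. The estimates are $$\hat f^{t}\in\arg\min_{f\in\mathcal F}\sum_{i<t}\sum_{h=1}^H\big(f_{c_i}(s^i_h,a^i_h)-\ell^i_h\big)^2,\qquad \hat P^{t}\in\arg\max_{P\in\mathcal P}\sum_{i<t}\sum_{h=1}^H\log P_{c_i}(s^i_{h+1}\mid s^i_h,a^i_h),$$ with $\log 0=-\infty$ and deterministic (measurable) tie-breaking; for $t=1$ they are arbitrary elements of the classes. For every context $c$, $\pi^1_c$ is uniform, and for $s\in S_h$, $a\in A$, $$b^t_\beta(c,s,a)=\min\Big\{1,\frac{\beta/2}{1+\sum_{i=1}^{t-1}q_h(s,a\mid\pi^i_c,\hat P^t_c)}\Big\},\qquad \hat\ell^t_c=\hat f^t_c-b^t_{\beta_\ell}(c,\cdot)-2H\,b^t_{\beta_P}(c,\cdot),$$ $$\hat V^t_{c,H+1}=0,\quad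 \hat Q^t_{c,h}(s,a)=\max\Big\{0,\hat\ell^t_c(s,a)+\sum_{s'}\hat P^t_c(s'\mid s,a)\hat V^t_{c,h+1}(s')\Big\},\quad \hat V^t_{c,h}(s)=\sum_a\pi^t_c(a\mid s)\hat Q^t_{c,h}(s,a),$$ $$\pi^{t+1}_c(a\mid s)\propto\pi^t_c(a\mid s)\exp\big(-\eta\,\hat Q^t_{c,h}(s,a)\big).$$ Write $\hat V^t_c(s_1)=\hat V^t_{c,1}(s_1)$. **Lemma.** For every $\delta\in(0,1)$, with probability at least $1-\delta/4$ over the run of the algorithm, $$\begin{aligned}\sum_{t=1}^T\mathbb E_{c}\big[V^{\pi^t_c}_c(s_1)-\hat V^t_c(s_1)\big]\le{}& H+\frac{112\,TH^3\log\big(128\,T^4H|\mathcal F||\mathcal P|/\delta^2\big)}{\beta_\ell}+\frac{25\,TH^4\log\big(8TH|\mathcal P|/\delta\big)}{\beta_P}\\&+2\,\mathbb E_c\Big[\sum_{t=2}^T\sum_{h=1}^H\sum_{s\in S_h}\sum_{a\in A}q_h(s,a\mid\pi^t_c,P^\star_c)\big(b^t_{\beta_\ell}(c,s,a)+2H\,b^t_{\beta_P}(c,s,a)\big)\Big].\end{aligned}$$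 -/

import Mathlib

open MeasureTheory

/-! Finite-horizon, loop-free contextual MDPs.
Time steps inside an episode are numbered `1, …, H` (`h : ℕ`); the coordinate `i : Fin H` of a
path stands for the time step `i + 1`. Episodes (rounds) are numbered from `0`, so that the index
`t` stands for the `(t+1)`-st episode and is preceded by exactly `t` episodes. -/

/-- A decomposition of the state space into the layers `S_1, …, S_{H+1}`, where `S_1 = {s₁}` and
`S_{H+1} = {sEnd}`; `layer s` is the index of the layer that contains `s`. -/
structure Layering (S : Type*) (H : ℕ) where
  layer : S → ℕ
  s₁ : S
  sEnd : S
  layer_mem : ∀ s, 1 ≤ layer s ∧ layer s ≤ H + 1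
  layer_eq_one : ∀ s, layer s = 1 ↔ s = s₁
  layer_eq_end : ∀ s, layer s = H + 1 ↔ s = sEnd

/-- `P : S × A → Δ_S` is a transition function that only moves from a layer to the next one.
Nothing but `P s a ∈ Δ_S` is required at the end state, where the episode is over. -/
def Layering.IsDynamics {S A : Type*} [Fintype S] {H : ℕ} (L : Layering S H)
    (P : S → A → S → ℝ) : Prop :=
  (∀ s a, P s a ∈ stdSimplex ℝ S) ∧
    ∀ s a s', L.layer s ≤ H → L.layer s' ≠ L.layer s + 1 → P s a s' = 0

section SingleContext

variable {S A : Type*} [Fintype S] [Fintype A] {H : ℕ}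

open scoped Classical in
/-- Probability that the policy `π` and the dynamics `P`, started at `s₁`, generate the states
`x = (s_1, …, s_{H+1})` and the actions `y = (a_1, …, a_H)`. -/
noncomputable def pathProb (s₁ : S) (P : S → A → S → ℝ) (π : S → A → ℝ)
    (x : Fin (H + 1) → S) (y : Fin H → A) : ℝ :=
  (if x 0 = s₁ then 1 else 0) *
    ∏ i : Fin H, π (x i.castSucc) (y i) * P (x i.castSucc) (y i) (x i.succ)

/-- `E_{π,P}[∑_{h=1}^H ℓ(s_h,a_h) | s_1 = s₁]`, the value of `π` at the initial state. -/
noncomputable def value (H : ℕ) (s₁ : S) (P : S → A → S → ℝ) (ℓ : S → A → ℝ) (π : S → A → ℝ) : ℝ :=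
  ∑ x : Fin (H + 1) → S, ∑ y : Fin H → A,
    pathProb s₁ P π x y * ∑ i : Fin H, ℓ (x i.castSucc) (y i)

open scoped Classical in
/-- Occupancy measure `q_h(s,a | π,P)`: the probability of being at `s` and performing `a` at time
step `h ∈ {1, …, H}`. -/
noncomputable def occ (H : ℕ) (s₁ : S) (P : S → A → S → ℝ) (π : S → A → ℝ)
    (h : ℕ) (s : S) (a : A) : ℝ :=
  ∑ x : Fin (H + 1) → S, ∑ y : Fin H → A,
    if ∃ i : Fin H, (i : ℕ) + 1 = h ∧ x i.castSucc = s ∧ y i = a then pathProb s₁ P π x y else 0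

/-- Exploration bonus with parameter `β` at `(s,a)`, where `s ∈ S_h` with `h = L.layer s`, computed
from the policies `past` of the `t` preceding rounds and from the current dynamics estimate. -/
noncomputable def bonus (L : Layering S H) (β : ℝ) {t : ℕ} (past : Fin t → S → A → ℝ)
    (Phat : S → A → S → ℝ) (s : S) (a : A) : ℝ :=
  min 1 ((β / 2) / (1 + ∑ i : Fin t, occ H L.s₁ Phat (past i) (L.layer s) s a))

/-- Optimistic loss estimate `f̂ - (b_{β_ℓ} + 2 H b_{β_P})`. -/
noncomputable def optLoss (L : Layering S H) (βℓ βP : ℝ) {t : ℕ} (past : Fin t → S → A → ℝ)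
    (fhat : S → A → ℝ) (Phat : S → A → S → ℝ) (s : S) (a : A) : ℝ :=
  fhat s a - (bonus L βℓ past Phat s a + 2 * H * bonus L βP past Phat s a)

/-- Truncated policy evaluation with `n` steps to go, that is, `Q̂_h` with `h = H + 1 - n`:
`Q̂_{H+1} = 0`, `Q̂_h(s,a) = max {0, ℓ̂(s,a) + ∑_{s'} P̂(s'|s,a) V̂_{h+1}(s')}` and
`V̂_h(s) = ⟨π(·|s), Q̂_h(s,·)⟩`. -/
noncomputable def evalQ (Phat : S → A → S → ℝ) (lhat : S → A → ℝ) (π : S → A → ℝ) :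
    ℕ → S → A → ℝ
  | 0 => fun _ _ => 0
  | n + 1 => fun s a =>
      max 0 (lhat s a + ∑ s', Phat s a s' * ∑ a', π s' a' * evalQ Phat lhat π n s' a')

/-- The policies of the algorithm for one fixed context, given the loss and dynamics estimates
`fhat t`, `Phat t` of all rounds: uniform at first, then exponential weights,
`π^{t+1}(a|s) ∝ π^t(a|s) exp(-η Q̂^t_h(s,a))` for `s ∈ S_h`. -/
noncomputable def polIter (L : Layering S H) (η βℓ βP : ℝ) (fhat : ℕ → S → A → ℝ)
    (Phat : ℕ → S → A → S → ℝ) : ℕ → S → A → ℝ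
  | 0 => fun _ _ => 1 / (Fintype.card A : ℝ)
  | t + 1 => fun s a =>
      let π := polIter L η βℓ βP fhat Phat t
      let lhat := optLoss L βℓ βP (fun i : Fin t => polIter L η βℓ βP fhat Phat i)
        (fhat t) (Phat t)
      let Q := evalQ (Phat t) lhat π (H + 1 - L.layer s) s
      π s a * Real.exp (-η * Q a) / ∑ a', π s a' * Real.exp (-η * Q a')
termination_by t => t
decreasing_by
  · omega
  · have := i.isLt
    omega

end SingleContext

section Contextual

variable {C S A : Type*} [Fintype C] [Fintype S] [Fintype A] {H : ℕ}

/-- A stochastic contextual MDP: the context distribution `D`, the transition functions `P_c`, and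
the distributions of the observed losses, which are supported in `[0,1]`. -/
structure CMDP (C S A : Type*) [Fintype C] [Fintype S] (H : ℕ) extends Layering S H where
  D : C → ℝ
  D_mem : D ∈ stdSimplex ℝ C
  P : C → S → A → S → ℝ
  isDynamics : ∀ c, toLayering.IsDynamics (P c)
  lossLaw : C → S → A → Measure ℝ
  isProb : ∀ c s a, IsProbabilityMeasure (lossLaw c s a)
  loss_mem : ∀ c s a, ∀ᵐ x ∂lossLaw c s a, x ∈ Set.Icc (0 : ℝ) 1

/-- The expected loss `ℓ_c(s,a)`. -/
noncomputable def CMDP.loss (M : CMDP C S A H) (c : C) (s : S) (a : A) : ℝ :=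
  ∫ x, x ∂M.lossLaw c s a

/-- Expectation over a fresh context. -/
noncomputable def CMDP.expect (M : CMDP C S A H) (g : C → ℝ) : ℝ := ∑ c, M.D c * g c

/-- What is observed in one episode: the context, the states `s_1, …, s_{H+1}`, the actions
`a_1, …, a_H` and the losses of the `H` steps. -/
abbrev Episode (C S A : Type*) (H : ℕ) := C × (Fin (H + 1) → S) × (Fin H → A) × (Fin H → ℝ)

/-- Law of an episode in which the context-dependent policy `π` is played: `c ∼ D`, then
`a_h ∼ π_c(·|s_h)` and `s_{h+1} ∼ P_c(·|s_h,a_h)`, and, given these, the losses are independent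
with `ℓ_h ∼ lossLaw c s_h a_h`. -/
noncomputable def CMDP.episodeLaw [MeasurableSpace C] [MeasurableSpace S] [MeasurableSpace A]
    (M : CMDP C S A H) (π : C → S → A → ℝ) : Measure (Episode C S A H) :=
  ∑ c : C, ∑ x : Fin (H + 1) → S, ∑ y : Fin H → A,
    ENNReal.ofReal (M.D c * pathProb M.s₁ (M.P c) (π c) x y) •
      (Measure.pi fun i : Fin H => M.lossLaw c (x i.castSucc) (y i)).map
        (fun l : Fin H → ℝ => ((c, x, y, l) : Episode C S A H))

/-- Cumulative squared error of `f` on a dataset. -/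
noncomputable def sqError {t : ℕ} (f : C → S → A → ℝ) (d : Fin t → Episode C S A H) : ℝ :=
  ∑ i : Fin t, ∑ j : Fin H,
    (f (d i).1 ((d i).2.1 j.castSucc) ((d i).2.2.1 j) - (d i).2.2.2 j) ^ 2

/-- Log-likelihood of the transitions in a dataset, with `log 0 = -∞`. -/
noncomputable def logLik {t : ℕ} (P : C → S → A → S → ℝ) (d : Fin t → Episode C S A H) : EReal :=
  ∑ i : Fin t, ∑ j : Fin H,
    ENNReal.log (ENNReal.ofReal
      (P (d i).1 ((d i).2.1 j.castSucc) ((d i).2.2.1 j) ((d i).2.1 j.succ)))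

variable [MeasurableSpace C] [MeasurableSpace S] [MeasurableSpace A]

/-- Least squares regression oracle: a (measurable) rule that sends every dataset to a minimizer
of the squared error over the class `𝓕`. -/
structure IsLeastSquaresOracle (𝓕 : Finset (C → S → A → ℝ))
    (O : ∀ t : ℕ, (Fin t → Episode C S A H) → C → S → A → ℝ) : Prop where
  measurable : ∀ t, Measurable (O t)
  mem : ∀ t d, O t d ∈ 𝓕
  isMin : ∀ t d, ∀ f ∈ 𝓕, sqError (O t d) d ≤ sqError f d

/-- Log loss regression oracle: a (measurable) rule that sends every dataset to a maximizer
of the log-likelihood over the class `𝓟`. -/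
structure IsLogLossOracle (𝓟 : Finset (C → S → A → S → ℝ))
    (O : ∀ t : ℕ, (Fin t → Episode C S A H) → C → S → A → S → ℝ) : Prop where
  measurable : ∀ t, Measurable (O t)
  mem : ∀ t d, O t d ∈ 𝓟
  isMax : ∀ t d, ∀ P ∈ 𝓟, logLik P d ≤ logLik (O t d) d
/-- Input of the algorithm: learning rate, bonus parameters and the two oracles. -/
structure Learner (C S A : Type*) (H : ℕ) where
  η : ℝ
  βℓ : ℝ
  βP : ℝ
  fOracle : ∀ t : ℕ, (Fin t → Episode C S A H) → C → S → A → ℝ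
  pOracle : ∀ t : ℕ, (Fin t → Episode C S A H) → C → S → A → S → ℝ

section Algorithm

variable (M : CMDP C S A H) (G : Learner C S A H) (σ : ℕ → Episode C S A H)

/-- The loss estimate of round `t` when the observed episodes are `σ`. -/
def fHat (t : ℕ) : C → S → A → ℝ := G.fOracle t fun i : Fin t => σ i

/-- The dynamics estimate of round `t` when the observed episodes are `σ`. -/
def pHat (t : ℕ) : C → S → A → S → ℝ := G.pOracle t fun i : Fin t => σ i

/-- The context-dependent policy of round `t`. It depends on `σ` only through the episodes that
precede round `t`. -/
noncomputable def pol (t : ℕ) (c : C) : S → A → ℝ :=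
  polIter M.toLayering G.η G.βℓ G.βP (fun k => fHat G σ k c) (fun k => pHat G σ k c) t

/-- The bonus `b^t_β(c,s,a)`. -/
noncomputable def bonusAt (β : ℝ) (t : ℕ) (c : C) : S → A → ℝ :=
  bonus M.toLayering β (fun i : Fin t => pol M G σ i c) (pHat G σ t c)

/-- The estimated value `V̂^t_c(s_1) = V̂^t_{c,1}(s_1)`. -/
noncomputable def vHat (t : ℕ) (c : C) : ℝ :=
  ∑ a, pol M G σ t c M.s₁ a *
    evalQ (pHat G σ t c)
      (optLoss M.toLayering G.βℓ G.βP (fun i : Fin t => pol M G σ i c)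
        (fHat G σ t c) (pHat G σ t c))
      (pol M G σ t c) H M.s₁ a

end Algorithm

/-- The random episodes `σ 0, …, σ (T-1)` come from running the algorithm for `T` rounds: given
the preceding episodes, the conditional law of episode `t` is the law of an episode in which the
policy of round `t` is played. -/
structure IsRun {Ω : Type*} [MeasurableSpace Ω] (μ : Measure Ω) (M : CMDP C S A H)
    (G : Learner C S A H) (T : ℕ) (σ : ℕ → Ω → Episode C S A H) : Prop where
  measurable : ∀ t < T, Measurable (σ t)
  condLaw : ∀ t < T, ∀ B : Set (Fin t → Episode C S A H), MeasurableSet B →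
    ∀ E : Set (Episode C S A H), MeasurableSet E →
      μ {ω | (fun i : Fin t => σ i ω) ∈ B ∧ σ t ω ∈ E} =
        ∫⁻ ω in {ω | (fun i : Fin t => σ i ω) ∈ B},
          M.episodeLaw (pol M G (fun k => σ k ω) t) E ∂μ

end Contextual

/-! The bonuses make `vHat` optimistic up to errors that the two regression oracles control on past
policies. The value difference lemma `value_sub_evalQ_le` bounds the gap of one round by an
expectation, under the true dynamics, of the loss error, the bonuses and `2 * H` times the total
variation error of the transitions. With `N` the estimated visits, AM-GM in the form `u ≤ β / (2 *
N) + N * u ^ 2 / (2 * β)` (`le_min_one_add`) charges each error `u` to its bonus plus a multiple of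
`N * u ^ 2`. The bonuses are thus paid twice, which explains the factor 2. As a current occupancy is
at most 1, weighting `u ^ 2` by `N` turns its expectation into a sum over past policies run in the
estimated dynamics (`value_visits_mul_le`). Returning to the true dynamics costs a squared Hellinger
distance of path laws, `1 - bhatt` up to a factor (`value_le_two_mul_value_add`), which also
controls the transition errors (`value_tvDist_sq_le`).

It remains to bound these errors along the run. For a fixed candidate, both the exponential of minus
`1 / H` times the excess squared loss and the square root of the likelihood ratio have conditional
means at most `exp (-error)`, up to scaling the error. Compensated products therefore have mean at
most 1 (`IsRun.lintegral_prod_le_one`). Markov's inequality and a union bound over rounds and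
candidates apply to the data-dependent estimates, whose uncompensated products are at least 1
because they beat the truth on the data. -/

theorem pathProb_nonneg {S A : Type*} {H : ℕ} {s₁ : S} {P : S → A → S → ℝ} {π : S → A → ℝ}
    (hP : ∀ s a s', 0 ≤ P s a s') (hπ : ∀ s a, 0 ≤ π s a)
    (x : Fin (H + 1) → S) (y : Fin H → A) : 0 ≤ pathProb s₁ P π x y := by
  unfold pathProb
  refine mul_nonneg (by split_ifs <;> norm_num) (Finset.prod_nonneg fun i _ => ?_)
  exact mul_nonneg (hπ _ _) (hP _ _ _)

/-! ### Path sums, state marginals and occupancy measures -/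

section PathCalculus

variable {S A : Type*} [Fintype S] [Fintype A]

/-- One step of the evolution of a (signed) measure on the states. -/
noncomputable def stepLaw (P : S → A → S → ℝ) (π : S → A → ℝ) (μ : S → ℝ) (s' : S) : ℝ :=
  ∑ s, ∑ a, μ s * (π s a * P s a s')

/-- The weight of a path when the initial state is distributed according to `μ`. -/
noncomputable def pathWeight {H : ℕ} (P : S → A → S → ℝ) (π : S → A → ℝ) (μ : S → ℝ)
    (x : Fin (H + 1) → S) (y : Fin H → A) : ℝ :=
  μ (x 0) * ∏ i : Fin H, π (x i.castSucc) (y i) * P (x i.castSucc) (y i) (x i.succ)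

/-- The weight of the first step is absorbed into the initial measure of the remaining path. This is
why `μ` is arbitrary and not a point mass. -/
theorem sum_pathWeight_cons {H : ℕ} (P : S → A → S → ℝ) (π : S → A → ℝ) (μ : S → ℝ)
    (F : (Fin (H + 2) → S) → (Fin (H + 1) → A) → ℝ) :
    ∑ x : Fin (H + 2) → S, ∑ y : Fin (H + 1) → A, pathWeight P π μ x y * F x y =
      ∑ s, ∑ a, ∑ x : Fin (H + 1) → S, ∑ y : Fin H → A,
        pathWeight P π (fun s' => μ s * (π s a * P s a s')) x y *
          F (Fin.cons s x) (Fin.cons a y) := by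
  rw [← (Fin.consEquiv (fun _ : Fin (H + 2) => S)).sum_comp, Fintype.sum_prod_type]
  refine Finset.sum_congr rfl fun s _ => ?_
  rw [Finset.sum_comm]
  rw [← (Fin.consEquiv (fun _ : Fin (H + 1) => A)).sum_comp, Fintype.sum_prod_type]
  refine Finset.sum_congr rfl fun a _ => ?_
  rw [Finset.sum_comm]
  refine Finset.sum_congr rfl fun x _ => Finset.sum_congr rfl fun y _ => ?_
  congr 1
  simp only [pathWeight, Fin.consEquiv_apply, Fin.cons_zero, Fin.prod_univ_succ, Fin.castSucc_zero,
    Fin.cons_succ, ← Fin.succ_castSucc]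
  ring

theorem sum_pathWeight_tail {H : ℕ} (P : S → A → S → ℝ) (π : S → A → ℝ) (μ : S → ℝ)
    (F : (Fin (H + 1) → S) → (Fin H → A) → ℝ) :
    ∑ x : Fin (H + 2) → S, ∑ y : Fin (H + 1) → A,
        pathWeight P π μ x y * F (fun i => x i.succ) (fun i => y i.succ) =
      ∑ x : Fin (H + 1) → S, ∑ y : Fin H → A, pathWeight P π (stepLaw P π μ) x y * F x y := by
  rw [sum_pathWeight_cons P π μ fun x y => F (fun i => x i.succ) (fun i => y i.succ)]
  simp only [Fin.cons_succ]
  have : ∀ s : S, ∑ a : A, ∑ x : Fin (H + 1) → S, ∑ y : Fin H → A,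
        pathWeight P π (fun s' => μ s * (π s a * P s a s')) x y * F x y =
      ∑ x : Fin (H + 1) → S, ∑ y : Fin H → A, ∑ a : A,
        pathWeight P π (fun s' => μ s * (π s a * P s a s')) x y * F x y := by
    intro s
    rw [Finset.sum_comm]
    exact Finset.sum_congr rfl fun x _ => Finset.sum_comm
  simp only [this]
  rw [Finset.sum_comm]
  refine Finset.sum_congr rfl fun x _ => ?_
  rw [Finset.sum_comm]
  refine Finset.sum_congr rfl fun y _ => ?_
  simp only [pathWeight, stepLaw, Finset.sum_mul]

/-- No normalization is assumed, so that this also computes the Bhattacharyya coefficient, where the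
kernel `geomKernel` is only sub-Markov. -/
theorem sum_pathWeight (H : ℕ) (P : S → A → S → ℝ) (π : S → A → ℝ) (μ : S → ℝ) :
    ∑ x : Fin (H + 1) → S, ∑ y : Fin H → A, pathWeight P π μ x y =
      ∑ s, (stepLaw P π)^[H] μ s := by
  induction H generalizing μ with
  | zero =>
    simp only [pathWeight, Finset.univ_eq_empty, Finset.prod_empty, mul_one, Finset.sum_const,
      Finset.card_univ, Fintype.card_unique, one_smul, Function.iterate_zero, id_eq]
    rw [← (Equiv.funUnique (Fin 1) S).symm.sum_comp]
    rfl
  | succ H ih =>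
    have := sum_pathWeight_tail (H := H) P π μ fun _ _ => 1
    simp only [mul_one] at this
    rw [this, ih, Function.iterate_succ_apply]

theorem sum_stepLaw {P : S → A → S → ℝ} {π : S → A → ℝ}
    (hP : ∀ s a, P s a ∈ stdSimplex ℝ S) (hπ : ∀ s, π s ∈ stdSimplex ℝ A) (μ : S → ℝ) :
    ∑ s, stepLaw P π μ s = ∑ s, μ s := by
  unfold stepLaw
  rw [Finset.sum_comm]
  refine Finset.sum_congr rfl fun s _ => ?_
  rw [Finset.sum_comm]
  simp only [← Finset.mul_sum, (hP _ _).2, (hπ _).2, mul_one]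

theorem sum_iterate_stepLaw {P : S → A → S → ℝ} {π : S → A → ℝ}
    (hP : ∀ s a, P s a ∈ stdSimplex ℝ S) (hπ : ∀ s, π s ∈ stdSimplex ℝ A) (μ : S → ℝ) (n : ℕ) :
    ∑ s, (stepLaw P π)^[n] μ s = ∑ s, μ s := by
  induction n with
  | zero => rfl
  | succ n ih => rw [Function.iterate_succ_apply', sum_stepLaw hP hπ, ih]

/-- Steps before `i` evolve the initial measure; steps after `i` integrate to 1 because the kernels
are Markov. -/
theorem sum_pathWeight_mul {H : ℕ} {P : S → A → S → ℝ} {π : S → A → ℝ}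
    (hP : ∀ s a, P s a ∈ stdSimplex ℝ S) (hπ : ∀ s, π s ∈ stdSimplex ℝ A) (μ : S → ℝ)
    (i : Fin H) (φ : S → A → ℝ) :
    ∑ x : Fin (H + 1) → S, ∑ y : Fin H → A, pathWeight P π μ x y * φ (x i.castSucc) (y i) =
      ∑ s, ∑ a, (stepLaw P π)^[i] μ s * π s a * φ s a := by
  induction H generalizing μ with
  | zero => exact i.elim0
  | succ H ih =>
    refine Fin.cases ?_ (fun j => ?_) i
    · rw [sum_pathWeight_cons P π μ fun x y => φ (x (Fin.castSucc 0)) (y 0)]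
      refine Finset.sum_congr rfl fun s _ => Finset.sum_congr rfl fun a _ => ?_
      simp only [Fin.castSucc_zero, Fin.cons_zero, ← Finset.sum_mul, sum_pathWeight,
        sum_iterate_stepLaw hP hπ, ← Finset.mul_sum, (hP _ _).2]
      simp
    · have := sum_pathWeight_tail P π μ fun x y => φ (x j.castSucc) (y j)
      simp only [← Fin.succ_castSucc]
      rw [this, ih]
      rfl

/-- The law of the `(n+1)`-st state. -/
noncomputable def stateLaw (s₁ : S) (P : S → A → S → ℝ) (π : S → A → ℝ) (n : ℕ) : S → ℝ :=
  open scoped Classical in (stepLaw P π)^[n] fun s => if s = s₁ then 1 else 0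

theorem stateLaw_succ (s₁ : S) (P : S → A → S → ℝ) (π : S → A → ℝ) (n : ℕ) :
    stateLaw s₁ P π (n + 1) = stepLaw P π (stateLaw s₁ P π n) :=
  Function.iterate_succ_apply' _ _ _

theorem stateLaw_nonneg {s₁ : S} {P : S → A → S → ℝ} {π : S → A → ℝ}
    (hP : ∀ s a s', 0 ≤ P s a s') (hπ : ∀ s a, 0 ≤ π s a) (n : ℕ) (s : S) :
    0 ≤ stateLaw s₁ P π n s := by
  induction n generalizing s with
  | zero => simp only [stateLaw, Function.iterate_zero, id_eq]; split_ifs <;> norm_num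
  | succ n ih =>
    rw [stateLaw_succ]
    exact Finset.sum_nonneg fun s _ => Finset.sum_nonneg fun a _ =>
      mul_nonneg (ih s) (mul_nonneg (hπ _ _) (hP _ _ _))

theorem sum_stateLaw {s₁ : S} {P : S → A → S → ℝ} {π : S → A → ℝ}
    (hP : ∀ s a, P s a ∈ stdSimplex ℝ S) (hπ : ∀ s, π s ∈ stdSimplex ℝ A) (n : ℕ) :
    ∑ s, stateLaw s₁ P π n s = 1 := by
  classical
  rw [stateLaw, sum_iterate_stepLaw hP hπ]
  simp only [Finset.sum_ite_eq', Finset.mem_univ, if_true]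

theorem sum_pathProb (H : ℕ) (s₁ : S) (P : S → A → S → ℝ) (π : S → A → ℝ) :
    ∑ x : Fin (H + 1) → S, ∑ y : Fin H → A, pathProb s₁ P π x y =
      ∑ s, stateLaw s₁ P π H s := by
  classical
  exact sum_pathWeight H P π fun s => if s = s₁ then 1 else 0

theorem sum_pathProb_mul {H : ℕ} {s₁ : S} {P : S → A → S → ℝ} {π : S → A → ℝ}
    (hP : ∀ s a, P s a ∈ stdSimplex ℝ S) (hπ : ∀ s, π s ∈ stdSimplex ℝ A)
    (i : Fin H) (φ : S → A → ℝ) :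
    ∑ x : Fin (H + 1) → S, ∑ y : Fin H → A, pathProb s₁ P π x y * φ (x i.castSucc) (y i) =
      ∑ s, ∑ a, stateLaw s₁ P π i s * π s a * φ s a :=
  open scoped Classical in sum_pathWeight_mul hP hπ (fun s => if s = s₁ then 1 else 0) i φ

theorem value_eq_sum_stateLaw {H : ℕ} {s₁ : S} {P : S → A → S → ℝ} {π : S → A → ℝ}
    (hP : ∀ s a, P s a ∈ stdSimplex ℝ S) (hπ : ∀ s, π s ∈ stdSimplex ℝ A) (φ : S → A → ℝ) :
    value H s₁ P φ π =
      ∑ n ∈ Finset.range H, ∑ s, ∑ a, stateLaw s₁ P π n s * π s a * φ s a := by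
  rw [Finset.sum_range]
  simp only [← sum_pathProb_mul hP hπ, value, Finset.mul_sum]
  simp only [Finset.sum_comm (s := (Finset.univ : Finset (Fin H)))]

/-- Time steps are counted from 1 in `occ` and from 0 in `stateLaw`, hence the shift. -/
theorem occ_eq_stateLaw {H : ℕ} {s₁ : S} {P : S → A → S → ℝ} {π : S → A → ℝ}
    (hP : ∀ s a, P s a ∈ stdSimplex ℝ S) (hπ : ∀ s, π s ∈ stdSimplex ℝ A) {n : ℕ} (hn : n < H)
    (s : S) (a : A) : occ H s₁ P π (n + 1) s a = stateLaw s₁ P π n s * π s a := by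
  classical
  have := sum_pathProb_mul (s₁ := s₁) hP hπ ⟨n, hn⟩ fun s' a' => if s' = s ∧ a' = a then 1 else 0
  have h0 : ∑ s', ∑ a', stateLaw s₁ P π n s' * π s' a' * (if s' = s ∧ a' = a then 1 else 0) =
      stateLaw s₁ P π n s * π s a := by
    rw [Finset.sum_eq_single s, Finset.sum_eq_single a] <;> simp +contextual
  rw [← h0, ← this]
  unfold occ
  refine Finset.sum_congr rfl fun x _ => Finset.sum_congr rfl fun y _ => ?_
  rw [mul_ite, mul_one, mul_zero]
  refine if_congr ⟨?_, fun h => ⟨⟨n, hn⟩, rfl, h⟩⟩ rfl rfl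
  rintro ⟨i, hi, h⟩
  obtain rfl : i = ⟨n, hn⟩ := Fin.ext (by simpa using hi)
  exact h

/-- Each step raises the layer by one. The bound `n ≤ H` ensures that every transition used starts
in a layer at most `H`, where the layer constraint is in force. -/
theorem stateLaw_eq_zero {H : ℕ} (L : Layering S H) {P : S → A → S → ℝ} {π : S → A → ℝ}
    (hP : L.IsDynamics P) {n : ℕ} (hn : n ≤ H) {s : S} (hs : L.layer s ≠ n + 1) :
    stateLaw L.s₁ P π n s = 0 := by
  induction n generalizing s with
  | zero =>
    have : s ≠ L.s₁ := fun h => hs (by simpa using (L.layer_eq_one s).2 h)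
    simp [stateLaw, this]
  | succ n ih =>
    rw [stateLaw_succ]
    refine Finset.sum_eq_zero fun s' _ => Finset.sum_eq_zero fun a _ => ?_
    by_cases h : L.layer s' = n + 1
    · rw [hP.2 s' a s (by omega) (by omega)]; simp
    · rw [ih (by omega) h]; simp

/-- Restricting step `h` to layer `h` loses no mass. This produces the occupancy form of the bonus
term. -/
theorem value_eq_sum_occ {H : ℕ} (L : Layering S H) {P : S → A → S → ℝ} {π : S → A → ℝ}
    (hP : L.IsDynamics P) (hπ : ∀ s, π s ∈ stdSimplex ℝ A) (φ : S → A → ℝ) :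
    value H L.s₁ P φ π =
      ∑ h ∈ Finset.Icc 1 H, ∑ s with L.layer s = h, ∑ a, occ H L.s₁ P π h s a * φ s a := by
  have h1 : Finset.Icc 1 H = Finset.Ico (0 + 1) (H + 1) := by ext; simp
  rw [value_eq_sum_stateLaw hP.1 hπ, h1, ← Finset.sum_Ico_add' , ← Finset.range_eq_Ico]
  refine Finset.sum_congr rfl fun n hn => ?_
  have hn' := Finset.mem_range.1 hn
  rw [Finset.sum_filter]
  refine Finset.sum_congr rfl fun s _ => ?_
  split_ifs with h
  · simp only [occ_eq_stateLaw hP.1 hπ hn']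
  · rw [stateLaw_eq_zero L hP hn'.le h]; simp

end PathCalculus

/-! ### Hellinger distance of path laws and change of measure -/

section Hellinger

variable {S A : Type*} [Fintype S] [Fintype A]

/-- The pointwise geometric mean of two kernels. -/
noncomputable def geomKernel {S A : Type*} (P Q : S → A → S → ℝ) (s : S) (a : A) (s' : S) : ℝ :=
  √(P s a s' * Q s a s')

/-- The Bhattacharyya coefficient of the laws of the paths that `π` generates under `P` and `Q`. -/
noncomputable def bhatt (H : ℕ) (s₁ : S) (P Q : S → A → S → ℝ) (π : S → A → ℝ) : ℝ :=
  ∑ s, stateLaw s₁ (geomKernel P Q) π H s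

variable {H : ℕ} {s₁ : S} {P Q : S → A → S → ℝ} {π : S → A → ℝ}

theorem sum_geomKernel_le_one {S A : Type*} [Fintype S] {P Q : S → A → S → ℝ}
    (hP : ∀ s a, P s a ∈ stdSimplex ℝ S)
    (hQ : ∀ s a, Q s a ∈ stdSimplex ℝ S) (s : S) (a : A) : ∑ s', geomKernel P Q s a s' ≤ 1 := by
  have := Real.sum_sqrt_mul_sqrt_le Finset.univ (fun s' => (hP s a).1 s') fun s' => (hQ s a).1 s'
  rw [(hP s a).2, (hQ s a).2] at this
  simpa [geomKernel, Real.sqrt_mul ((hP s a).1 _)] using this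

/-- Data processing for the Bhattacharyya coefficient: Cauchy–Schwarz over the previous state and
action, by induction on time. -/
theorem stateLaw_geomKernel_le (hP : ∀ s a s', 0 ≤ P s a s') (hQ : ∀ s a s', 0 ≤ Q s a s')
    (hπ : ∀ s a, 0 ≤ π s a) (n : ℕ) (s : S) :
    stateLaw s₁ (geomKernel P Q) π n s ≤ √(stateLaw s₁ P π n s * stateLaw s₁ Q π n s) := by
  induction n generalizing s with
  | zero => simp only [stateLaw, Function.iterate_zero, id_eq]; split_ifs <;> simp
  | succ n ih =>
    have hp := stateLaw_nonneg (s₁ := s₁) hP hπ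
    have hq := stateLaw_nonneg (s₁ := s₁) hQ hπ
    have key := Real.sum_sqrt_mul_sqrt_le (Finset.univ : Finset (S × A))
      (f := fun z => stateLaw s₁ P π n z.1 * (π z.1 z.2 * P z.1 z.2 s))
      (g := fun z => stateLaw s₁ Q π n z.1 * (π z.1 z.2 * Q z.1 z.2 s))
      (fun z => mul_nonneg (hp _ _) (mul_nonneg (hπ _ _) (hP _ _ _)))
      (fun z => mul_nonneg (hq _ _) (mul_nonneg (hπ _ _) (hQ _ _ _)))
    rw [Fintype.sum_prod_type, Fintype.sum_prod_type, Fintype.sum_prod_type] at key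
    simp only [stateLaw_succ, stepLaw]
    rw [Real.sqrt_mul (Finset.sum_nonneg fun z _ => Finset.sum_nonneg fun a _ =>
      mul_nonneg (hp _ _) (mul_nonneg (hπ _ _) (hP _ _ _)))]
    refine le_trans (Finset.sum_le_sum fun z _ => Finset.sum_le_sum fun a _ => ?_) key
    have e : √(stateLaw s₁ P π n z * (π z a * P z a s)) *
        √(stateLaw s₁ Q π n z * (π z a * Q z a s)) =
        √(stateLaw s₁ P π n z * stateLaw s₁ Q π n z) * (π z a * geomKernel P Q z a s) := by
      rw [geomKernel, Real.sqrt_mul (hp _ _), Real.sqrt_mul (hq _ _), Real.sqrt_mul (hπ _ _),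
        Real.sqrt_mul (hπ _ _), Real.sqrt_mul (hp _ _), Real.sqrt_mul (hP _ _ _)]
      linear_combination (√(stateLaw s₁ P π n z) * √(stateLaw s₁ Q π n z) * √(P z a s) *
        √(Q z a s)) * Real.mul_self_sqrt (hπ z a)
    rw [e]
    exact mul_le_mul_of_nonneg_right (ih z) (mul_nonneg (hπ _ _) (Real.sqrt_nonneg _))

/-- The rows of `geomKernel` have mass at most 1, so the total mass decreases with time. -/
theorem bhatt_le_sum_stateLaw (hP : ∀ s a, P s a ∈ stdSimplex ℝ S)
    (hQ : ∀ s a, Q s a ∈ stdSimplex ℝ S) (hπ : ∀ s, π s ∈ stdSimplex ℝ A) {n : ℕ} (hn : n ≤ H) :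
    bhatt H s₁ P Q π ≤ ∑ s, stateLaw s₁ (geomKernel P Q) π n s := by
  induction H, hn using Nat.le_induction with
  | base => rfl
  | succ m _ ih =>
    refine le_trans ?_ ih
    unfold bhatt
    simp only [stateLaw_succ, stepLaw]
    rw [Finset.sum_comm]
    refine Finset.sum_le_sum fun s _ => ?_
    rw [Finset.sum_comm]
    simp only [← Finset.mul_sum]
    have h0 : 0 ≤ stateLaw s₁ (geomKernel P Q) π m s :=
      stateLaw_nonneg (fun _ _ _ => Real.sqrt_nonneg _) (fun s a => (hπ s).1 a) m s
    refine mul_le_of_le_one_right h0 ?_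
    rw [← (hπ s).2]
    exact Finset.sum_le_sum fun a _ =>
      mul_le_of_le_one_right ((hπ s).1 a) (sum_geomKernel_le_one hP hQ s a)

theorem bhatt_le_sum_sqrt_stateLaw (hP : ∀ s a, P s a ∈ stdSimplex ℝ S)
    (hQ : ∀ s a, Q s a ∈ stdSimplex ℝ S) (hπ : ∀ s, π s ∈ stdSimplex ℝ A) {n : ℕ} (hn : n ≤ H) :
    bhatt H s₁ P Q π ≤ ∑ s, √(stateLaw s₁ P π n s) * √(stateLaw s₁ Q π n s) := by
  refine (bhatt_le_sum_stateLaw hP hQ hπ hn).trans (Finset.sum_le_sum fun s _ => ?_)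
  rw [← Real.sqrt_mul (stateLaw_nonneg (fun s a => (hP s a).1) (fun s => (hπ s).1) n s)]
  exact stateLaw_geomKernel_le (fun s a => (hP s a).1) (fun s a => (hQ s a).1)
    (fun s => (hπ s).1) n s

theorem sum_sq_sqrt_stateLaw_sub_le (hP : ∀ s a, P s a ∈ stdSimplex ℝ S)
    (hQ : ∀ s a, Q s a ∈ stdSimplex ℝ S) (hπ : ∀ s, π s ∈ stdSimplex ℝ A) {n : ℕ} (hn : n ≤ H) :
    ∑ s, (√(stateLaw s₁ P π n s) - √(stateLaw s₁ Q π n s)) ^ 2 ≤ 2 * (1 - bhatt H s₁ P Q π) := by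
  have hp := stateLaw_nonneg (s₁ := s₁) (fun s a => (hP s a).1) (fun s => (hπ s).1) n
  have hq := stateLaw_nonneg (s₁ := s₁) (fun s a => (hQ s a).1) (fun s => (hπ s).1) n
  have e : ∀ s, (√(stateLaw s₁ P π n s) - √(stateLaw s₁ Q π n s)) ^ 2 =
      stateLaw s₁ P π n s + stateLaw s₁ Q π n s -
        2 * (√(stateLaw s₁ P π n s) * √(stateLaw s₁ Q π n s)) := fun s => by
    rw [sub_sq, Real.sq_sqrt (hp s), Real.sq_sqrt (hq s)]; ring
  simp only [e, Finset.sum_sub_distrib, Finset.sum_add_distrib, ← Finset.mul_sum,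
    sum_stateLaw hP hπ, sum_stateLaw hQ hπ]
  linarith [bhatt_le_sum_sqrt_stateLaw (s₁ := s₁) hP hQ hπ hn]

/-- Change of measure at the cost of a squared Hellinger distance. -/
theorem value_le_two_mul_value_add (hP : ∀ s a, P s a ∈ stdSimplex ℝ S)
    (hQ : ∀ s a, Q s a ∈ stdSimplex ℝ S) (hπ : ∀ s, π s ∈ stdSimplex ℝ A) {φ : S → A → ℝ}
    (hφ : ∀ s a, φ s a ∈ Set.Icc (0 : ℝ) 1) :
    value H s₁ P φ π ≤ 2 * value H s₁ Q φ π + 4 * H * (1 - bhatt H s₁ P Q π) := by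
  rw [value_eq_sum_stateLaw hP hπ, value_eq_sum_stateLaw hQ hπ]
  have key : ∀ n ∈ Finset.range H, ∑ s, ∑ a, stateLaw s₁ P π n s * π s a * φ s a ≤
      2 * ∑ s, ∑ a, stateLaw s₁ Q π n s * π s a * φ s a + 4 * (1 - bhatt H s₁ P Q π) := by
    intro n hn
    have hp := stateLaw_nonneg (s₁ := s₁) (fun s a => (hP s a).1) (fun s => (hπ s).1) n
    have hq := stateLaw_nonneg (s₁ := s₁) (fun s a => (hQ s a).1) (fun s => (hπ s).1) n
    have h2 := sum_sq_sqrt_stateLaw_sub_le (s₁ := s₁) hP hQ hπ (Finset.mem_range.1 hn).le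
    have h3 : ∑ s, ∑ a, stateLaw s₁ P π n s * π s a * φ s a ≤
        ∑ s, (2 * ∑ a, stateLaw s₁ Q π n s * π s a * φ s a +
          2 * (√(stateLaw s₁ P π n s) - √(stateLaw s₁ Q π n s)) ^ 2) := by
      refine Finset.sum_le_sum fun s _ => ?_
      simp only [mul_assoc, ← Finset.mul_sum]
      set g := ∑ a, π s a * φ s a
      have g0 : 0 ≤ g := Finset.sum_nonneg fun a _ => mul_nonneg ((hπ s).1 a) (hφ s a).1
      have g1 : g ≤ 1 := by
        rw [← (hπ s).2]
        exact Finset.sum_le_sum fun a _ => mul_le_of_le_one_right ((hπ s).1 a) (hφ s a).2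
      -- With `p` and `q` the two masses, the right side minus the left side is `(√p - 2 * √q) ^ 2`.
      have h4 : stateLaw s₁ P π n s ≤ 2 * stateLaw s₁ Q π n s +
          2 * (√(stateLaw s₁ P π n s) - √(stateLaw s₁ Q π n s)) ^ 2 := by
        nlinarith [Real.sq_sqrt (hp s), Real.sq_sqrt (hq s),
          sq_nonneg (√(stateLaw s₁ P π n s) - 2 * √(stateLaw s₁ Q π n s))]
      nlinarith [mul_le_mul_of_nonneg_right h4 g0,
        mul_nonneg (sq_nonneg (√(stateLaw s₁ P π n s) - √(stateLaw s₁ Q π n s))) (sub_nonneg.2 g1)]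
    rw [Finset.sum_add_distrib, ← Finset.mul_sum, ← Finset.mul_sum] at h3
    linarith
  refine (Finset.sum_le_sum key).trans (le_of_eq ?_)
  rw [Finset.sum_add_distrib, ← Finset.mul_sum]
  simp
  ring

theorem value_mono (hP : ∀ s a, P s a ∈ stdSimplex ℝ S) (hπ : ∀ s, π s ∈ stdSimplex ℝ A)
    {φ ψ : S → A → ℝ} (h : ∀ s a, φ s a ≤ ψ s a) : value H s₁ P φ π ≤ value H s₁ P ψ π := by
  rw [value_eq_sum_stateLaw hP hπ, value_eq_sum_stateLaw hP hπ]
  refine Finset.sum_le_sum fun n _ => Finset.sum_le_sum fun s _ => Finset.sum_le_sum fun a _ => ?_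
  exact mul_le_mul_of_nonneg_left (h s a) (mul_nonneg (stateLaw_nonneg (fun s a => (hP s a).1)
    (fun s => (hπ s).1) n s) ((hπ s).1 a))

theorem value_const (hP : ∀ s a, P s a ∈ stdSimplex ℝ S) (hπ : ∀ s, π s ∈ stdSimplex ℝ A)
    (r : ℝ) : value H s₁ P (fun _ _ => r) π = H * r := by
  rw [value_eq_sum_stateLaw hP hπ]
  simp only [mul_assoc, ← Finset.mul_sum, ← Finset.sum_mul, (hπ _).2, one_mul, sum_stateLaw hP hπ]
  simp

theorem value_add (φ ψ : S → A → ℝ) :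
    value H s₁ P (fun s a => φ s a + ψ s a) π = value H s₁ P φ π + value H s₁ P ψ π := by
  simp only [value, Finset.sum_add_distrib, mul_add]

theorem value_smul (r : ℝ) (φ : S → A → ℝ) :
    value H s₁ P (fun s a => r * φ s a) π = r * value H s₁ P φ π := by
  simp only [value, ← Finset.mul_sum, mul_left_comm _ r]

/-- The squared Hellinger distances of the transitions are controlled by that of the path laws. -/
theorem value_sq_sqrt_sub_le (hP : ∀ s a, P s a ∈ stdSimplex ℝ S)
    (hQ : ∀ s a, Q s a ∈ stdSimplex ℝ S) (hπ : ∀ s, π s ∈ stdSimplex ℝ A) :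
    value H s₁ P (fun s a => ∑ s', (√(P s a s') - √(Q s a s')) ^ 2) π ≤
      8 * H * (1 - bhatt H s₁ P Q π) := by
  rw [value_eq_sum_stateLaw hP hπ]
  have key : ∀ n ∈ Finset.range H,
      ∑ s, ∑ a, stateLaw s₁ P π n s * π s a * ∑ s', (√(P s a s') - √(Q s a s')) ^ 2 ≤
        8 * (1 - bhatt H s₁ P Q π) := by
    intro n hn
    have hn := Finset.mem_range.1 hn
    have hp := stateLaw_nonneg (s₁ := s₁) (fun s a => (hP s a).1) (fun s => (hπ s).1) n
    have hq := stateLaw_nonneg (s₁ := s₁) (fun s a => (hQ s a).1) (fun s => (hπ s).1) n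
    have h1 := sum_sq_sqrt_stateLaw_sub_le (s₁ := s₁) hP hQ hπ hn.le
    -- Stopping at time `n + 1` keeps the kernel of step `n` visible, while the earlier steps are
    -- merged into the marginals.
    have h2 : bhatt H s₁ P Q π ≤ ∑ s, ∑ a, ∑ s', π s a *
        (√(stateLaw s₁ P π n s) * √(stateLaw s₁ Q π n s) * (√(P s a s') * √(Q s a s'))) := by
      refine (bhatt_le_sum_stateLaw hP hQ hπ (Nat.succ_le_iff.2 hn)).trans ?_
      simp only [stateLaw_succ, stepLaw]
      rw [Finset.sum_comm]
      refine Finset.sum_le_sum fun s _ => ?_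
      rw [Finset.sum_comm]
      refine Finset.sum_le_sum fun a _ => Finset.sum_le_sum fun s' _ => ?_
      rw [geomKernel, Real.sqrt_mul ((hP s a).1 _), mul_left_comm, ← Real.sqrt_mul (hp s)]
      exact mul_le_mul_of_nonneg_left (mul_le_mul_of_nonneg_right
        (stateLaw_geomKernel_le (fun s a => (hP s a).1) (fun s a => (hQ s a).1)
          (fun s => (hπ s).1) n s) (by positivity)) ((hπ s).1 a)
    -- With `x, y, z, w` the roots of the two marginals and the two transition probabilities, `x *
    -- (z - w) = (x * z - y * w) + (y - x) * w`, and a squared sum is at most twice the sum of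
    -- squares. Each part sums to at most `4 * (1 - bhatt)`.
    have h3 : ∀ s a, stateLaw s₁ P π n s * π s a * ∑ s', (√(P s a s') - √(Q s a s')) ^ 2 ≤
        2 * (stateLaw s₁ P π n s * (π s a * ∑ s', P s a s') +
          stateLaw s₁ Q π n s * (π s a * ∑ s', Q s a s')) -
        4 * ∑ s', π s a *
          (√(stateLaw s₁ P π n s) * √(stateLaw s₁ Q π n s) * (√(P s a s') * √(Q s a s'))) +
        2 * ((√(stateLaw s₁ P π n s) - √(stateLaw s₁ Q π n s)) ^ 2 *
          (π s a * ∑ s', Q s a s')) := by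
      intro s a
      simp only [Finset.mul_sum, ← Finset.sum_add_distrib, ← Finset.sum_sub_distrib]
      refine Finset.sum_le_sum fun s' _ => ?_
      have e1 := Real.sq_sqrt (hp s)
      have e2 := Real.sq_sqrt (hq s)
      have e3 := Real.sq_sqrt ((hP s a).1 s')
      have e4 := Real.sq_sqrt ((hQ s a).1 s')
      have h0 := (hπ s).1 a
      generalize √(stateLaw s₁ P π n s) = x at *
      generalize √(stateLaw s₁ Q π n s) = y at *
      generalize √(P s a s') = z at *
      generalize √(Q s a s') = w at *
      rw [← e1, ← e2, ← e3, ← e4]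
      nlinarith [mul_nonneg h0 (sq_nonneg (x * z - y * w - (y - x) * w))]
    refine (Finset.sum_le_sum fun s _ => Finset.sum_le_sum fun a _ => h3 s a).trans ?_
    simp only [Finset.sum_add_distrib, Finset.sum_sub_distrib, ← Finset.mul_sum, (hP _ _).2,
      (hQ _ _).2, (hπ _).2, mul_one, sum_stateLaw hP hπ, sum_stateLaw hQ hπ] at h2 ⊢
    linarith
  refine (Finset.sum_le_sum key).trans (le_of_eq ?_)
  simp
  ring

/-- Half the `ℓ¹` distance. -/
noncomputable def tvDist (p q : S → ℝ) : ℝ := (∑ s, |p s - q s|) / 2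

theorem tvDist_nonneg (p q : S → ℝ) : 0 ≤ tvDist p q :=
  div_nonneg (Finset.sum_nonneg fun _ _ => abs_nonneg _) zero_le_two

theorem tvDist_le_one {p q : S → ℝ} (hp : p ∈ stdSimplex ℝ S) (hq : q ∈ stdSimplex ℝ S) :
    tvDist p q ≤ 1 := by
  have : ∑ s, |p s - q s| ≤ ∑ s, (p s + q s) := Finset.sum_le_sum fun s _ => by
    rw [abs_le]; constructor <;> linarith [hp.1 s, hq.1 s]
  rw [Finset.sum_add_distrib, hp.2, hq.2] at this
  unfold tvDist
  linarith

/-- Factor `|p - q|` as `|√p - √q| * (√p + √q)` and apply Cauchy–Schwarz; the squares of the second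
factor sum to at most 4. -/
theorem tvDist_sq_le {p q : S → ℝ} (hp : p ∈ stdSimplex ℝ S) (hq : q ∈ stdSimplex ℝ S) :
    tvDist p q ^ 2 ≤ ∑ s, (√(p s) - √(q s)) ^ 2 := by
  have h1 := Finset.sum_mul_sq_le_sq_mul_sq Finset.univ (fun s => |√(p s) - √(q s)|)
    fun s => √(p s) + √(q s)
  have h2 : ∀ s, |√(p s) - √(q s)| * (√(p s) + √(q s)) = |p s - q s| := fun s => by
    rw [← abs_of_nonneg (add_nonneg (Real.sqrt_nonneg (p s)) (Real.sqrt_nonneg (q s))), ← abs_mul]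
    congr 1
    linear_combination Real.sq_sqrt (hp.1 s) - Real.sq_sqrt (hq.1 s)
  have h3 : ∑ s, (√(p s) + √(q s)) ^ 2 ≤ ∑ s, (2 * p s + 2 * q s) := Finset.sum_le_sum fun s _ => by
    nlinarith [Real.sq_sqrt (hp.1 s), Real.sq_sqrt (hq.1 s), sq_nonneg (√(p s) - √(q s))]
  rw [Finset.sum_add_distrib, ← Finset.mul_sum, ← Finset.mul_sum, hp.2, hq.2] at h3
  simp only [h2, sq_abs] at h1
  have h4 : 0 ≤ ∑ s, (√(p s) - √(q s)) ^ 2 := Finset.sum_nonneg fun _ _ => sq_nonneg _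
  unfold tvDist
  nlinarith [mul_le_mul_of_nonneg_left h3 h4]

theorem value_tvDist_sq_le (hP : ∀ s a, P s a ∈ stdSimplex ℝ S)
    (hQ : ∀ s a, Q s a ∈ stdSimplex ℝ S) (hπ : ∀ s, π s ∈ stdSimplex ℝ A) :
    value H s₁ P (fun s a => tvDist (P s a) (Q s a) ^ 2) π ≤ 8 * H * (1 - bhatt H s₁ P Q π) :=
  (value_mono hP hπ fun s a => tvDist_sq_le (hP s a) (hQ s a)).trans
    (value_sq_sqrt_sub_le hP hQ hπ)

end Hellinger

/-! ### Optimism of the estimated value for a fixed context -/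

section RegretDecomposition

variable {S A : Type*} [Fintype S] [Fintype A] {H : ℕ}

/-- Truncation alone gives the lower bound, however negative `lhat` is. The range controls the cost
of a wrong transition in the value difference lemma. -/
theorem evalQ_mem_Icc {Phat : S → A → S → ℝ} {lhat : S → A → ℝ} {π : S → A → ℝ}
    (hP : ∀ s a, Phat s a ∈ stdSimplex ℝ S) (hπ : ∀ s, π s ∈ stdSimplex ℝ A)
    (hl : ∀ s a, lhat s a ≤ 1) (n : ℕ) (s : S) (a : A) :
    evalQ Phat lhat π n s a ∈ Set.Icc (0 : ℝ) n := by
  induction n generalizing s a with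
  | zero => simp [evalQ]
  | succ n ih =>
    refine ⟨le_max_left _ _, max_le (by positivity) ?_⟩
    have h1 : ∀ s', ∑ a', π s' a' * evalQ Phat lhat π n s' a' ≤ n := fun s' => by
      refine (Finset.sum_le_sum fun a' _ =>
        mul_le_mul_of_nonneg_left (ih s' a').2 ((hπ s').1 a')).trans ?_
      rw [← Finset.sum_mul, (hπ s').2, one_mul]
    have h2 : ∑ s', Phat s a s' * ∑ a', π s' a' * evalQ Phat lhat π n s' a' ≤ n := by
      refine (Finset.sum_le_sum fun s' _ =>
        mul_le_mul_of_nonneg_left (h1 s') ((hP s a).1 s')).trans ?_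
      rw [← Finset.sum_mul, (hP s a).2, one_mul]
    push_cast
    linarith [hl s a]

/-- The value difference lemma for the truncated evaluation `evalQ`. -/
theorem value_sub_evalQ_le {s₁ : S} {P Phat : S → A → S → ℝ} {ℓ lhat : S → A → ℝ}
    {π : S → A → ℝ} (hP : ∀ s a, P s a ∈ stdSimplex ℝ S) (hPh : ∀ s a, Phat s a ∈ stdSimplex ℝ S)
    (hπ : ∀ s, π s ∈ stdSimplex ℝ A) (hl : ∀ s a, lhat s a ≤ 1) :
    value H s₁ P ℓ π - ∑ a, π s₁ a * evalQ Phat lhat π H s₁ a ≤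
      value H s₁ P (fun s a => ℓ s a - lhat s a + 2 * H * tvDist (Phat s a) (P s a)) π := by
  classical
  set v : ℕ → S → ℝ := fun n s => ∑ a, π s a * evalQ Phat lhat π n s a with hv
  have hq := evalQ_mem_Icc hPh hπ hl
  have v0 : ∀ n s, 0 ≤ v n s := fun n s =>
    Finset.sum_nonneg fun a _ => mul_nonneg ((hπ s).1 a) (hq n s a).1
  have v1 : ∀ n ≤ H, ∀ s, v n s ≤ H := fun n hn s => by
    have hn' : (n : ℝ) ≤ H := by exact_mod_cast hn
    refine (Finset.sum_le_sum fun a _ =>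
      mul_le_mul_of_nonneg_left ((hq n s a).2.trans hn') ((hπ s).1 a)).trans ?_
    rw [← Finset.sum_mul, (hπ s).2, one_mul]
  set d := stateLaw s₁ P π with hd
  have d0 := stateLaw_nonneg (s₁ := s₁) (fun s a => (hP s a).1) (fun s => (hπ s).1)
  -- The estimated value at `s₁` is telescoped along the state laws of the true dynamics; the
  -- boundary term vanishes because no steps remain.
  have tele : ∑ a, π s₁ a * evalQ Phat lhat π H s₁ a =
      ∑ n ∈ Finset.range H, (∑ s, d n s * v (H - n) s - ∑ s, d (n + 1) s * v (H - (n + 1)) s) := by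
    rw [Finset.sum_range_sub' (fun n => ∑ s, d n s * v (H - n) s)]
    simp [hd, hv, stateLaw, evalQ]
  rw [tele, value_eq_sum_stateLaw hP hπ, value_eq_sum_stateLaw hP hπ, ← Finset.sum_sub_distrib]
  simp only [← hd]
  refine Finset.sum_le_sum fun n hn => ?_
  obtain ⟨m, hm⟩ : ∃ m, H - n = m + 1 := ⟨H - n - 1, by have := Finset.mem_range.1 hn; omega⟩
  have hm' : H - (n + 1) = m := by omega
  rw [hm, hm']
  have e1 : ∑ s, d (n + 1) s * v m s = ∑ s, ∑ a, d n s * π s a * ∑ s', P s a s' * v m s' := by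
    simp only [hd, stateLaw_succ, stepLaw, Finset.sum_mul, Finset.mul_sum]
    rw [Finset.sum_comm]
    refine Finset.sum_congr rfl fun s _ => ?_
    rw [Finset.sum_comm]
    exact Finset.sum_congr rfl fun a _ => Finset.sum_congr rfl fun s' _ => by ring
  have e2 : ∑ s, d n s * v (m + 1) s =
      ∑ s, ∑ a, d n s * π s a * evalQ Phat lhat π (m + 1) s a := by
    simp only [hv, Finset.mul_sum, mul_assoc]
  rw [e1, e2]
  simp only [← Finset.sum_sub_distrib, ← mul_sub]
  refine Finset.sum_le_sum fun s _ => Finset.sum_le_sum fun a _ => ?_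
  refine mul_le_mul_of_nonneg_left ?_ (mul_nonneg (d0 n s) ((hπ s).1 a))
  -- Truncation at 0 only raises the estimate, which is the harmless direction for an upper bound on
  -- the gap.
  have h1 : lhat s a + ∑ s', Phat s a s' * v m s' ≤ evalQ Phat lhat π (m + 1) s a := by
    rw [evalQ]
    exact le_max_right _ _
  have h2 : ∑ s', P s a s' * v m s' - ∑ s', Phat s a s' * v m s' ≤
      2 * H * tvDist (Phat s a) (P s a) := by
    rw [← Finset.sum_sub_distrib, tvDist, mul_comm 2, mul_assoc, mul_div_cancel₀ _ two_ne_zero,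
      Finset.mul_sum]
    refine Finset.sum_le_sum fun s' _ => ?_
    rw [← sub_mul, abs_sub_comm, mul_comm]
    exact (mul_le_mul_of_nonneg_left (le_abs_self _) (v0 m s')).trans
      (mul_le_mul_of_nonneg_right (v1 m (by omega) s') (abs_nonneg _))
  linarith

/-- AM-GM: the difference of the two sides without the cap is the square `(β - N * u) ^ 2 / (2 * β *
N)`. The cap at 1 is free because `u ≤ 1`. -/
theorem le_min_one_add {β N u : ℝ} (hβ : 0 < β) (hN : 1 ≤ N) (h1 : u ≤ 1) :
    u ≤ min 1 ((β / 2) / N) + 1 / (2 * β) * (N * u ^ 2) := by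
  have hN0 : 0 < N := by linarith
  have h2 : 0 ≤ 1 / (2 * β) * (N * u ^ 2) := by positivity
  rw [← min_add_add_right]
  refine le_min (by linarith) ?_
  have : (β / 2) / N + 1 / (2 * β) * (N * u ^ 2) - u = (β - N * u) ^ 2 / (2 * β * N) := by
    field_simp
    ring
  have : 0 ≤ (β - N * u) ^ 2 / (2 * β * N) := by positivity
  linarith

theorem occ_nonneg {s₁ : S} {P : S → A → S → ℝ} {π : S → A → ℝ}
    (hP : ∀ s a s', 0 ≤ P s a s') (hπ : ∀ s a, 0 ≤ π s a) (h : ℕ) (s : S) (a : A) :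
    0 ≤ occ H s₁ P π h s a :=
  Finset.sum_nonneg fun x _ => Finset.sum_nonneg fun y _ => by
    split_ifs
    exacts [pathProb_nonneg hP hπ x y, le_rfl]

/-- One plus the number of visits that is expected under the estimated dynamics. -/
noncomputable def visits (L : Layering S H) {t : ℕ} (past : Fin t → S → A → ℝ)
    (Phat : S → A → S → ℝ) (s : S) (a : A) : ℝ :=
  1 + ∑ i : Fin t, occ H L.s₁ Phat (past i) (L.layer s) s a

theorem one_le_visits (L : Layering S H) {t : ℕ} {past : Fin t → S → A → ℝ}
    {Phat : S → A → S → ℝ} (hP : ∀ s a, Phat s a ∈ stdSimplex ℝ S)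
    (hπ : ∀ i s, past i s ∈ stdSimplex ℝ A) (s : S) (a : A) : 1 ≤ visits L past Phat s a :=
  le_add_of_nonneg_right (Finset.sum_nonneg fun i _ =>
    occ_nonneg (fun s a => (hP s a).1) (fun s => (hπ i s).1) _ s a)

theorem bonus_nonneg (L : Layering S H) {β : ℝ} (hβ : 0 < β) {t : ℕ} {past : Fin t → S → A → ℝ}
    {Phat : S → A → S → ℝ} (hP : ∀ s a, Phat s a ∈ stdSimplex ℝ S)
    (hπ : ∀ i s, past i s ∈ stdSimplex ℝ A) (s : S) (a : A) : 0 ≤ bonus L β past Phat s a :=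
  le_min zero_le_one (div_nonneg (by linarith)
    (zero_le_one.trans (one_le_visits L hP hπ s a)))

theorem le_bonus_add (L : Layering S H) {β : ℝ} (hβ : 0 < β) {t : ℕ} {past : Fin t → S → A → ℝ}
    {Phat : S → A → S → ℝ} (hP : ∀ s a, Phat s a ∈ stdSimplex ℝ S)
    (hπ : ∀ i s, past i s ∈ stdSimplex ℝ A) (s : S) (a : A) {u : ℝ} (hu : u ≤ 1) :
    u ≤ bonus L β past Phat s a + 1 / (2 * β) * (visits L past Phat s a * u ^ 2) :=
  le_min_one_add hβ (one_le_visits L hP hπ s a) hu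

/-- The visit count contains the past occupancies under `Phat`. Bounding the current occupancy by 1
in front of them leaves past values of `φ`; the summand 1 in `visits` gives at most `H`. -/
theorem value_visits_mul_le (L : Layering S H) {t : ℕ} {past : Fin t → S → A → ℝ}
    {P Phat : S → A → S → ℝ} {π : S → A → ℝ} (hP : L.IsDynamics P) (hPh : L.IsDynamics Phat)
    (hπ : ∀ s, π s ∈ stdSimplex ℝ A) (hpast : ∀ i s, past i s ∈ stdSimplex ℝ A)
    {φ : S → A → ℝ} (hφ : ∀ s a, φ s a ∈ Set.Icc (0 : ℝ) 1) :
    value H L.s₁ P (fun s a => visits L past Phat s a * φ s a) π ≤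
      H + ∑ i, value H L.s₁ Phat φ (past i) := by
  have e : (H : ℝ) = value H L.s₁ P (fun _ _ => 1) π := by rw [value_const hP.1 hπ, mul_one]
  rw [e]
  simp only [value_eq_sum_stateLaw hP.1 hπ, value_eq_sum_stateLaw hPh.1 (hpast _)]
  rw [Finset.sum_comm (s := (Finset.univ : Finset (Fin t))), ← Finset.sum_add_distrib]
  refine Finset.sum_le_sum fun n hn => ?_
  have hn := Finset.mem_range.1 hn
  rw [Finset.sum_comm (s := (Finset.univ : Finset (Fin t))), ← Finset.sum_add_distrib]
  refine Finset.sum_le_sum fun s _ => ?_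
  rw [Finset.sum_comm (s := (Finset.univ : Finset (Fin t))), ← Finset.sum_add_distrib]
  refine Finset.sum_le_sum fun a _ => ?_
  have hd : ∀ s, 0 ≤ stateLaw L.s₁ P π n s :=
    stateLaw_nonneg (fun s a => (hP.1 s a).1) (fun s => (hπ s).1) n
  have hi : ∀ i, 0 ≤ stateLaw L.s₁ Phat (past i) n s * past i s a := fun i =>
    mul_nonneg (stateLaw_nonneg (fun s a => (hPh.1 s a).1) (fun s => (hpast i s).1) n s)
      ((hpast i s).1 a)
  have hsum : ∑ i, stateLaw L.s₁ Phat (past i) n s * past i s a * φ s a =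
      (∑ i, stateLaw L.s₁ Phat (past i) n s * past i s a) * φ s a := by rw [Finset.sum_mul]
  have hs0 : 0 ≤ ∑ i, stateLaw L.s₁ Phat (past i) n s * past i s a :=
    Finset.sum_nonneg fun i _ => hi i
  rw [hsum]
  by_cases h : L.layer s = n + 1
  · have hd1 : stateLaw L.s₁ P π n s ≤ 1 := by
      rw [← sum_stateLaw (s₁ := L.s₁) hP.1 hπ n]
      exact Finset.single_le_sum (f := stateLaw L.s₁ P π n) (fun s _ => hd s) (Finset.mem_univ s)
    have hπ1 : π s a ≤ 1 := by
      rw [← (hπ s).2]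
      exact Finset.single_le_sum (f := π s) (fun a _ => (hπ s).1 a) (Finset.mem_univ a)
    have hq0 : 0 ≤ stateLaw L.s₁ P π n s * π s a := mul_nonneg (hd s) ((hπ s).1 a)
    have hq1 : stateLaw L.s₁ P π n s * π s a ≤ 1 := mul_le_one₀ hd1 ((hπ s).1 a) hπ1
    simp only [visits, h, occ_eq_stateLaw hPh.1 (hpast _) hn]
    generalize ∑ i, stateLaw L.s₁ Phat (past i) n s * past i s a = y at *
    generalize stateLaw L.s₁ P π n s * π s a = q at *
    nlinarith [mul_le_mul_of_nonneg_left (hφ s a).2 hq0,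
      mul_le_mul_of_nonneg_right hq1 (mul_nonneg hs0 (hφ s a).1)]
  · rw [stateLaw_eq_zero L hP hn.le h]
    simpa using mul_nonneg hs0 (hφ s a).1

/-- The optimism of the estimated value, up to the estimation errors on the past policies. -/
theorem value_sub_optimistic_le (L : Layering S H) {βℓ βP : ℝ} (hβℓ : 0 < βℓ) (hβP : 0 < βP)
    {t : ℕ} {past : Fin t → S → A → ℝ} {P Phat : S → A → S → ℝ} {ℓ fhat : S → A → ℝ}
    {π : S → A → ℝ} (hP : L.IsDynamics P) (hPh : L.IsDynamics Phat)
    (hπ : ∀ s, π s ∈ stdSimplex ℝ A) (hpast : ∀ i s, past i s ∈ stdSimplex ℝ A)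
    (hℓ : ∀ s a, ℓ s a ∈ Set.Icc (0 : ℝ) 1) (hfh : ∀ s a, fhat s a ∈ Set.Icc (0 : ℝ) 1) :
    value H L.s₁ P ℓ π -
        ∑ a, π L.s₁ a * evalQ Phat (optLoss L βℓ βP past fhat Phat) π H L.s₁ a ≤
      2 * value H L.s₁ P
          (fun s a => bonus L βℓ past Phat s a + 2 * H * bonus L βP past Phat s a) π +
        1 / (2 * βℓ) * (H + 2 * ∑ i, value H L.s₁ P (fun s a => (fhat s a - ℓ s a) ^ 2) (past i) +
          4 * H * ∑ i, (1 - bhatt H L.s₁ Phat P (past i))) +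
        H / βP * (H + 8 * H * ∑ i, (1 - bhatt H L.s₁ Phat P (past i))) := by
  have hb := fun {β : ℝ} (hβ : 0 < β) => bonus_nonneg L hβ hPh.1 hpast
  have hu : ∀ s a, |fhat s a - ℓ s a| ≤ 1 := fun s a => by
    rw [abs_le]; constructor <;> linarith [(hℓ s a).1, (hℓ s a).2, (hfh s a).1, (hfh s a).2]
  have hu2 : ∀ s a, (fhat s a - ℓ s a) ^ 2 ∈ Set.Icc (0 : ℝ) 1 := fun s a =>
    ⟨sq_nonneg _, (sq_le_one_iff_abs_le_one _).2 (hu s a)⟩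
  have hw : ∀ s a, tvDist (Phat s a) (P s a) ^ 2 ∈ Set.Icc (0 : ℝ) 1 := fun s a =>
    ⟨sq_nonneg _, pow_le_one₀ (tvDist_nonneg _ _) (tvDist_le_one (hPh.1 s a) (hP.1 s a))⟩
  have hl : ∀ s a, optLoss L βℓ βP past fhat Phat s a ≤ 1 := fun s a => by
    have h1 := hb hβℓ s a
    have h2 : 0 ≤ 2 * H * bonus L βP past Phat s a := mul_nonneg (by positivity) (hb hβP s a)
    unfold optLoss
    linarith [(hfh s a).2]
  have h1 := value_sub_evalQ_le (H := H) (s₁ := L.s₁) (ℓ := ℓ) hP.1 hPh.1 hπ hl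
  -- Each bonus occurs once as a subtracted part of `optLoss` and once as the bound on an estimation
  -- error, whence the factor 2.
  have h2 : ∀ s a, ℓ s a - optLoss L βℓ βP past fhat Phat s a +
        2 * H * tvDist (Phat s a) (P s a) ≤
      2 * (bonus L βℓ past Phat s a + 2 * H * bonus L βP past Phat s a) +
        (1 / (2 * βℓ) * (visits L past Phat s a * (fhat s a - ℓ s a) ^ 2) +
          H / βP * (visits L past Phat s a * tvDist (Phat s a) (P s a) ^ 2)) := fun s a => by
    have h3 := le_bonus_add L hβℓ hPh.1 hpast s a (hu s a)
    have h4 := mul_le_mul_of_nonneg_left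
      (le_bonus_add L hβP hPh.1 hpast s a (tvDist_le_one (hPh.1 s a) (hP.1 s a)))
      (show (0 : ℝ) ≤ 2 * H by positivity)
    have h5 : (2 : ℝ) * H * (1 / (2 * βP)) = H / βP := by field_simp
    rw [mul_add, ← mul_assoc (2 * (H : ℝ)) (1 / (2 * βP)), h5] at h4
    rw [sq_abs] at h3
    have h6 := neg_abs_le (fhat s a - ℓ s a)
    unfold optLoss
    linarith
  have h3 := h1.trans (value_mono (s₁ := L.s₁) (H := H) hP.1 hπ h2)
  rw [value_add, value_add, value_smul, value_smul, value_smul] at h3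
  -- The visit counts yield loss errors under `Phat`, whereas least squares controls them under `P`;
  -- hence the change of measure. Transition errors are compared directly with the Hellinger
  -- distance below.
  have h4 := mul_le_mul_of_nonneg_left ((value_visits_mul_le L hP hPh hπ hpast hu2).trans
    (add_le_add_right (Finset.sum_le_sum fun i _ =>
      value_le_two_mul_value_add hPh.1 hP.1 (hpast i) hu2) _))
    (show 0 ≤ 1 / (2 * βℓ) by positivity)
  have h5 := mul_le_mul_of_nonneg_left ((value_visits_mul_le L hP hPh hπ hpast hw).trans
    (add_le_add_right (Finset.sum_le_sum fun i _ =>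
      value_tvDist_sq_le hPh.1 hP.1 (hpast i)) _))
    (show 0 ≤ H / βP by positivity)
  rw [Finset.sum_add_distrib, ← Finset.mul_sum, ← Finset.mul_sum, ← add_assoc] at h4
  rw [← Finset.mul_sum] at h5
  linarith

theorem polIter_pos [Nonempty A] (L : Layering S H) (η βℓ βP : ℝ) (fhat : ℕ → S → A → ℝ)
    (Phat : ℕ → S → A → S → ℝ) (t : ℕ) (s : S) (a : A) :
    0 < polIter L η βℓ βP fhat Phat t s a := by
  induction t generalizing a with
  | zero =>
    rw [polIter]
    have := Fintype.card_pos (α := A)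
    positivity
  | succ t ih =>
    rw [polIter]
    exact div_pos (mul_pos (ih a) (Real.exp_pos _))
      (Finset.sum_pos (fun a' _ => mul_pos (ih a') (Real.exp_pos _)) Finset.univ_nonempty)

theorem polIter_mem_stdSimplex [Nonempty A] (L : Layering S H) (η βℓ βP : ℝ)
    (fhat : ℕ → S → A → ℝ) (Phat : ℕ → S → A → S → ℝ) (t : ℕ) (s : S) :
    polIter L η βℓ βP fhat Phat t s ∈ stdSimplex ℝ A := by
  refine ⟨fun a => (polIter_pos L η βℓ βP fhat Phat t s a).le, ?_⟩
  cases t with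
  | zero =>
    simp only [polIter]
    simp
  | succ t =>
    simp only [polIter]
    rw [← Finset.sum_div]
    exact div_self (Finset.sum_pos (fun a' _ =>
      mul_pos (polIter_pos L η βℓ βP fhat Phat t s a') (Real.exp_pos _)) Finset.univ_nonempty).ne'

/-- Causality of the updates: it allows a policy to be read as a function of the history alone. -/
theorem polIter_congr (L : Layering S H) (η βℓ βP : ℝ) {fhat fhat' : ℕ → S → A → ℝ}
    {Phat Phat' : ℕ → S → A → S → ℝ} {t : ℕ} (hf : ∀ k < t, fhat k = fhat' k)
    (hP : ∀ k < t, Phat k = Phat' k) :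
    polIter L η βℓ βP fhat Phat t = polIter L η βℓ βP fhat' Phat' t := by
  induction t using Nat.strong_induction_on with
  | _ t ih =>
    cases t with
    | zero => rw [polIter, polIter]
    | succ t =>
      have h1 : ∀ k ≤ t, polIter L η βℓ βP fhat Phat k = polIter L η βℓ βP fhat' Phat' k :=
        fun k hk => ih k (by omega) (fun j hj => hf j (by omega)) fun j hj => hP j (by omega)
      have h2 : (fun i : Fin t => polIter L η βℓ βP fhat Phat i) =
          fun i : Fin t => polIter L η βℓ βP fhat' Phat' i := funext fun i => h1 i i.2.le
      rw [polIter, polIter, h1 t le_rfl, h2, hf t (by omega), hP t (by omega)]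

end RegretDecomposition

open ProbabilityTheory

/-! ### Policies as functions of the history -/

section Policies

variable {C S A : Type*} [Fintype C] [Fintype S] [Fintype A] {H : ℕ}

theorem CMDP.pathProb_weight_nonneg (M : CMDP C S A H) {π : C → S → A → ℝ}
    (hπ : ∀ c s, π c s ∈ stdSimplex ℝ A) (c : C) (x : Fin (H + 1) → S) (y : Fin H → A) :
    0 ≤ M.D c * pathProb M.s₁ (M.P c) (π c) x y :=
  mul_nonneg (M.D_mem.1 c) (pathProb_nonneg (fun s a => ((M.isDynamics c).1 s a).1)
    (fun s => (hπ c s).1) x y)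

/-- The policy of round `t` as a function of the episodes that precede it. -/
noncomputable def histPol (M : CMDP C S A H) (G : Learner C S A H) (t : ℕ)
    (d : Fin t → Episode C S A H) (c : C) : S → A → ℝ :=
  polIter M.toLayering G.η G.βℓ G.βP
    (fun k => if h : k < t then G.fOracle k (fun i => d (Fin.castLE h.le i)) c else 0)
    (fun k => if h : k < t then G.pOracle k (fun i => d (Fin.castLE h.le i)) c else 0) t

theorem pol_eq_histPol (M : CMDP C S A H) (G : Learner C S A H) (σ : ℕ → Episode C S A H) (t : ℕ) :
    pol M G σ t = histPol M G t fun i => σ i := by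
  funext c
  refine polIter_congr _ _ _ _ (fun k hk => ?_) fun k hk => ?_ <;> simp only [hk, dif_pos] <;> rfl

theorem histPol_mem_stdSimplex [Nonempty A] (M : CMDP C S A H) (G : Learner C S A H) (t : ℕ)
    (d : Fin t → Episode C S A H) (c : C) (s : S) : histPol M G t d c s ∈ stdSimplex ℝ A :=
  polIter_mem_stdSimplex _ _ _ _ _ _ _ _

theorem pol_mem_stdSimplex [Nonempty A] (M : CMDP C S A H) (G : Learner C S A H)
    (σ : ℕ → Episode C S A H) (t : ℕ) (c : C) (s : S) : pol M G σ t c s ∈ stdSimplex ℝ A :=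
  polIter_mem_stdSimplex _ _ _ _ _ _ _ _

end Policies

/-! ### Conditional laws along the run and supermartingales -/

section Run

variable {C S A : Type*} [Fintype C] [MeasurableSpace C] [Fintype S] [MeasurableSpace S]
  [Fintype A] [MeasurableSpace A] {H : ℕ}

theorem CMDP.lintegral_episodeLaw (M : CMDP C S A H) (π : C → S → A → ℝ)
    {W : Episode C S A H → ENNReal} (hW : Measurable W) :
    ∫⁻ e, W e ∂M.episodeLaw π =
      ∑ c, ∑ x : Fin (H + 1) → S, ∑ y : Fin H → A,
        ENNReal.ofReal (M.D c * pathProb M.s₁ (M.P c) (π c) x y) *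
          ∫⁻ l, W (c, x, y, l) ∂(Measure.pi fun i : Fin H => M.lossLaw c (x i.castSucc) (y i)) := by
  unfold CMDP.episodeLaw
  simp only [lintegral_finsetSum_measure, lintegral_smul_measure, smul_eq_mul]
  refine Finset.sum_congr rfl fun c _ => Finset.sum_congr rfl fun x _ =>
    Finset.sum_congr rfl fun y _ => ?_
  rw [lintegral_map hW (by fun_prop)]

/-- A bound on the expectation of a function of an episode through its conditional expectation
given the contexts, states and actions. -/
theorem CMDP.lintegral_episodeLaw_le (M : CMDP C S A H) {π : C → S → A → ℝ}
    (hπ : ∀ c s, π c s ∈ stdSimplex ℝ A) {W : Episode C S A H → ENNReal} (hW : Measurable W)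
    {g : C → (Fin (H + 1) → S) → (Fin H → A) → ℝ} (hg : ∀ c x y, 0 ≤ g c x y)
    (h : ∀ c x y, ∫⁻ l, W (c, x, y, l)
      ∂(Measure.pi fun i : Fin H => M.lossLaw c (x i.castSucc) (y i)) ≤
        ENNReal.ofReal (g c x y)) :
    ∫⁻ e, W e ∂M.episodeLaw π ≤
      ENNReal.ofReal (M.expect fun c => ∑ x, ∑ y, pathProb M.s₁ (M.P c) (π c) x y * g c x y) := by
  have h0 := M.pathProb_weight_nonneg hπ
  have h1 : ∀ c x y, 0 ≤ M.D c * pathProb M.s₁ (M.P c) (π c) x y * g c x y := fun c x y =>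
    mul_nonneg (h0 c x y) (hg c x y)
  rw [M.lintegral_episodeLaw π hW, CMDP.expect]
  simp only [Finset.mul_sum, ← mul_assoc]
  rw [ENNReal.ofReal_sum_of_nonneg fun c _ => Finset.sum_nonneg fun x _ =>
    Finset.sum_nonneg fun y _ => h1 c x y]
  refine Finset.sum_le_sum fun c _ => ?_
  rw [ENNReal.ofReal_sum_of_nonneg fun x _ => Finset.sum_nonneg fun y _ => h1 c x y]
  refine Finset.sum_le_sum fun x _ => ?_
  rw [ENNReal.ofReal_sum_of_nonneg fun y _ => h1 c x y]
  refine Finset.sum_le_sum fun y _ => ?_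
  rw [ENNReal.ofReal_mul (h0 c x y)]
  gcongr
  exact h c x y

theorem CMDP.isProbabilityMeasure_episodeLaw (M : CMDP C S A H) {π : C → S → A → ℝ}
    (hπ : ∀ c s, π c s ∈ stdSimplex ℝ A) : IsProbabilityMeasure (M.episodeLaw π) := by
  have hp := M.isProb
  refine ⟨?_⟩
  have h0 := M.pathProb_weight_nonneg hπ
  rw [← lintegral_one, M.lintegral_episodeLaw π measurable_const]
  simp only [lintegral_const, measure_univ, mul_one]
  simp only [← ENNReal.ofReal_sum_of_nonneg fun y _ => h0 _ _ y]
  simp only [← ENNReal.ofReal_sum_of_nonneg fun x _ => Finset.sum_nonneg fun y _ => h0 _ x y]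
  rw [← ENNReal.ofReal_sum_of_nonneg fun c _ => Finset.sum_nonneg fun x _ =>
    Finset.sum_nonneg fun y _ => h0 c x y]
  simp only [← Finset.mul_sum, sum_pathProb, sum_stateLaw (M.isDynamics _).1 (hπ _), mul_one,
    M.D_mem.2, ENNReal.ofReal_one]

variable {𝓕 : Finset (C → S → A → ℝ)} {𝓟 : Finset (C → S → A → S → ℝ)}

/-- The policies take finitely many values, so that every function of them is measurable. -/
theorem measurable_comp_histPol (M : CMDP C S A H) {G : Learner C S A H}
    (hf : IsLeastSquaresOracle 𝓕 G.fOracle) (hp : IsLogLossOracle 𝓟 G.pOracle)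
    {β : Type*} [MeasurableSpace β] (Ψ : (C → S → A → ℝ) → β) (t : ℕ) :
    Measurable fun d => Ψ (histPol M G t d) := by
  let θ : (Fin t → Episode C S A H) → Fin t → 𝓕 × 𝓟 := fun d k =>
    (⟨G.fOracle k fun i => d (Fin.castLE k.2.le i), hf.mem _ _⟩,
      ⟨G.pOracle k fun i => d (Fin.castLE k.2.le i), hp.mem _ _⟩)
  have hθ : Measurable θ := by
    refine measurable_pi_iff.2 fun k => Measurable.prodMk ?_ ?_
    · exact ((hf.measurable k).comp
        (measurable_pi_iff.2 fun i => measurable_pi_apply (Fin.castLE k.2.le i))).subtype_mk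
    · exact ((hp.measurable k).comp
        (measurable_pi_iff.2 fun i => measurable_pi_apply (Fin.castLE k.2.le i))).subtype_mk
  let Φ : (Fin t → 𝓕 × 𝓟) → β := fun θ => Ψ fun c =>
    polIter M.toLayering G.η G.βℓ G.βP
      (fun k => if h : k < t then (θ ⟨k, h⟩).1.1 c else 0)
      (fun k => if h : k < t then (θ ⟨k, h⟩).2.1 c else 0) t
  have i1 : MeasurableSingletonClass 𝓕 := inferInstance
  have i2 : MeasurableSingletonClass (C → S → A → S → ℝ) := inferInstance
  have i3 : MeasurableSingletonClass 𝓟 := inferInstance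
  have i4 : MeasurableSingletonClass (𝓕 × 𝓟) := inferInstance
  have i5 : MeasurableSingletonClass (Fin t → 𝓕 × 𝓟) := inferInstance
  exact (Measurable.of_discrete (f := Φ)).comp hθ

/-- The conditional law of the next episode. -/
noncomputable def episodeKernel (M : CMDP C S A H) {G : Learner C S A H}
    (hf : IsLeastSquaresOracle 𝓕 G.fOracle) (hp : IsLogLossOracle 𝓟 G.pOracle) (t : ℕ) :
    Kernel (Fin t → Episode C S A H) (Episode C S A H) where
  toFun d := M.episodeLaw (histPol M G t d)
  measurable' := measurable_comp_histPol M hf hp _ t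

theorem isMarkovKernel_episodeKernel [Nonempty A] (M : CMDP C S A H) {G : Learner C S A H}
    (hf : IsLeastSquaresOracle 𝓕 G.fOracle) (hp : IsLogLossOracle 𝓟 G.pOracle) (t : ℕ) :
    IsMarkovKernel (episodeKernel M hf hp t) :=
  ⟨fun d => M.isProbabilityMeasure_episodeLaw (histPol_mem_stdSimplex M G t d)⟩

variable {Ω : Type*} [MeasurableSpace Ω] {μ : Measure Ω} {M : CMDP C S A H}
  {G : Learner C S A H} {T : ℕ} {σ : ℕ → Ω → Episode C S A H}

theorem IsRun.measurable_history (hrun : IsRun μ M G T σ) {t : ℕ} (ht : t ≤ T) :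
    Measurable fun ω (i : Fin t) => σ i ω :=
  measurable_pi_iff.2 fun i => hrun.measurable i (i.2.trans_le ht)

/-- The condition `condLaw` is this identity on measurable rectangles, which determine a finite
measure on the product. -/
theorem IsRun.map_history_prod [Nonempty A] [IsFiniteMeasure μ] (hrun : IsRun μ M G T σ)
    (hf : IsLeastSquaresOracle 𝓕 G.fOracle) (hp : IsLogLossOracle 𝓟 G.pOracle) {t : ℕ}
    (ht : t < T) :
    μ.map (fun ω => ((fun i : Fin t => σ i ω), σ t ω)) =
      (μ.map fun ω (i : Fin t) => σ i ω).compProd (episodeKernel M hf hp t) := by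
  have := isMarkovKernel_episodeKernel M hf hp t
  have hm := hrun.measurable_history ht.le
  refine Measure.ext_prod fun {B E} hB hE => ?_
  rw [Measure.map_apply (hm.prodMk (hrun.measurable t ht)) (hB.prod hE),
    Measure.compProd_apply_prod hB hE, setLIntegral_map hB (Kernel.measurable_coe _ hE) hm]
  refine (hrun.condLaw t ht B hB E hE).trans ?_
  simp only [pol_eq_histPol]
  rfl

/-- Given the history, the last factor has mean at most 1 while the others are constant; induct on
`n`. The factor `ψ` compensates for the played policy. -/
theorem IsRun.lintegral_prod_le_one [Nonempty A] [IsProbabilityMeasure μ]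
    (hrun : IsRun μ M G T σ) (hf : IsLeastSquaresOracle 𝓕 G.fOracle)
    (hp : IsLogLossOracle 𝓟 G.pOracle) {W : Episode C S A H → ENNReal} (hW : Measurable W)
    (ψ : (C → S → A → ℝ) → ENNReal)
    (h : ∀ π, (∀ c s, π c s ∈ stdSimplex ℝ A) → ψ π * ∫⁻ e, W e ∂M.episodeLaw π ≤ 1)
    {n : ℕ} (hn : n ≤ T) :
    Measurable (fun ω => ∏ i ∈ Finset.range n, (ψ (pol M G (fun k => σ k ω) i) * W (σ i ω))) ∧
    ∫⁻ ω, ∏ i ∈ Finset.range n, (ψ (pol M G (fun k => σ k ω) i) * W (σ i ω)) ∂μ ≤ 1 := by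
  have hψ : ∀ i ≤ T, Measurable fun ω => ψ (pol M G (fun k => σ k ω) i) := fun i hi => by
    simp only [pol_eq_histPol]
    exact (measurable_comp_histPol M hf hp ψ i).comp (hrun.measurable_history hi)
  refine ⟨Finset.measurable_prod _ fun i hi => ?_, ?_⟩
  · have := Finset.mem_range.1 hi
    exact (hψ i (by omega)).mul (hW.comp (hrun.measurable i (by omega)))
  induction n with
  | zero => simp
  | succ n ih =>
    have := isMarkovKernel_episodeKernel M hf hp n
    refine le_trans ?_ (ih (by omega))
    let R : (Fin n → Episode C S A H) → ENNReal := fun d =>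
      ∏ i : Fin n, (ψ (histPol M G i fun j => d (Fin.castLE i.2.le j)) * W (d i))
    have hR : Measurable R := by
      refine Finset.measurable_prod _ fun i _ => ?_
      exact ((measurable_comp_histPol M hf hp ψ i).comp
        (measurable_pi_iff.2 fun j => measurable_pi_apply (Fin.castLE i.2.le j))).mul
        (hW.comp (measurable_pi_apply (X := fun _ : Fin n => Episode C S A H) i))
    have eR : ∀ ω, ∏ i ∈ Finset.range n, (ψ (pol M G (fun k => σ k ω) i) * W (σ i ω)) =
        R fun i => σ i ω := fun ω => by
      rw [Finset.prod_range]
      simp only [pol_eq_histPol]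
      rfl
    have hψn := measurable_comp_histPol M hf hp ψ n
    have hF : Measurable fun z : (Fin n → Episode C S A H) × Episode C S A H =>
        R z.1 * ψ (histPol M G n z.1) * W z.2 :=
      ((hR.comp measurable_fst).mul (hψn.comp measurable_fst)).mul (hW.comp measurable_snd)
    have hm := hrun.measurable_history (t := n) (by omega)
    calc ∫⁻ ω, ∏ i ∈ Finset.range (n + 1), (ψ (pol M G (fun k => σ k ω) i) * W (σ i ω)) ∂μ
        = ∫⁻ ω, R (fun i => σ i ω) * ψ (histPol M G n fun i => σ i ω) * W (σ n ω) ∂μ := by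
          refine lintegral_congr fun ω => ?_
          rw [Finset.prod_range_succ, eR, pol_eq_histPol, mul_assoc]
      _ = ∫⁻ d, ∫⁻ e, R d * ψ (histPol M G n d) * W e ∂(episodeKernel M hf hp n d)
            ∂(μ.map fun ω (i : Fin n) => σ i ω) := by
          rw [← Measure.lintegral_compProd hF, ← hrun.map_history_prod hf hp (by omega),
            lintegral_map hF (hm.prodMk (hrun.measurable n (by omega)))]
      _ ≤ ∫⁻ d, R d ∂(μ.map fun ω (i : Fin n) => σ i ω) := by
          refine lintegral_mono fun d => ?_
          rw [lintegral_const_mul _ hW, mul_assoc]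
          exact mul_le_of_le_one_right' (h _ (histPol_mem_stdSimplex M G n d))
      _ = _ := by
          rw [lintegral_map hR hm]
          exact lintegral_congr fun ω => (eR ω).symm

/-- Ville-type deviation bound for the nonnegative supermartingale built from `w` and `a`. -/
theorem IsRun.measure_le_prod_mul_exp_le [Nonempty A] [IsProbabilityMeasure μ]
    (hrun : IsRun μ M G T σ) (hf : IsLeastSquaresOracle 𝓕 G.fOracle)
    (hp : IsLogLossOracle 𝓟 G.pOracle) {w : Episode C S A H → ℝ} (hw : Measurable w)
    (hw0 : ∀ e, 0 ≤ w e) (a : (C → S → A → ℝ) → ℝ)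
    (h : ∀ π, (∀ c s, π c s ∈ stdSimplex ℝ A) →
      ∫⁻ e, ENNReal.ofReal (w e) ∂M.episodeLaw π ≤ ENNReal.ofReal (Real.exp (-a π)))
    {n : ℕ} (hn : n ≤ T) {ε : ℝ} (hε : 0 < ε) :
    μ {ω | 1 / ε ≤ (∏ i ∈ Finset.range n, w (σ i ω)) *
      Real.exp (∑ i ∈ Finset.range n, a (pol M G (fun k => σ k ω) i))} ≤ ENNReal.ofReal ε := by
  obtain ⟨h1, h2⟩ := hrun.lintegral_prod_le_one hf hp hw.ennreal_ofReal
    (fun π => ENNReal.ofReal (Real.exp (a π))) (fun π hπ => by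
      refine (mul_le_mul_right (h π hπ) _).trans ?_
      rw [← ENNReal.ofReal_mul (Real.exp_pos _).le, ← Real.exp_add]
      simp) hn
  -- Markov's inequality at a fixed `n`; uniformity over rounds comes from a union bound.
  have h3 := (mul_meas_ge_le_lintegral h1 (ENNReal.ofReal (1 / ε))).trans h2
  have hpos : ENNReal.ofReal (1 / ε) ≠ 0 := by
    rw [Ne, ENNReal.ofReal_eq_zero, not_le]; positivity
  rw [mul_comm, ← ENNReal.le_div_iff_mul_le (Or.inl hpos) (Or.inl ENNReal.ofReal_ne_top), one_div,
    one_div, ENNReal.ofReal_inv_of_pos hε, inv_inv] at h3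
  refine le_trans (measure_mono fun ω hω => ?_) h3
  simp only [Set.mem_ofPred_eq] at hω ⊢
  rw [← ENNReal.ofReal_inv_of_pos hε, ← one_div]
  refine (ENNReal.ofReal_le_ofReal hω).trans (le_of_eq ?_)
  rw [Real.exp_sum, mul_comm, ← Finset.prod_mul_distrib, ENNReal.ofReal_prod_of_nonneg
    fun i _ => mul_nonneg (Real.exp_pos _).le (hw0 _)]
  exact Finset.prod_congr rfl fun i _ => ENNReal.ofReal_mul (Real.exp_pos _).le

end Run

/-! ### Exponential moments of the excess loss and of the likelihood ratio -/

theorem integrable_exp_excess_and_integral_le {ν : Measure ℝ} [IsProbabilityMeasure ν]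
    (hν : ∀ᵐ x ∂ν, x ∈ Set.Icc (0 : ℝ) 1) {r : ℝ} (hr0 : 0 ≤ r) (hr1 : r ≤ 1) (u : ℝ) :
    Integrable (fun x => Real.exp (-r * ((u - x) ^ 2 - ((∫ z, z ∂ν) - x) ^ 2))) ν ∧
      ∫ x, Real.exp (-r * ((u - x) ^ 2 - ((∫ z, z ∂ν) - x) ^ 2)) ∂ν ≤
        Real.exp (-(r / 2) * (u - ∫ z, z ∂ν) ^ 2) := by
  have hsub := hasSubgaussianMGF_of_mem_Icc (X := fun x : ℝ => x) (μ := ν) aemeasurable_id' hν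
  set m := ∫ z, z ∂ν with hm
  -- The excess is affine in `x`: it equals `(u - m) ^ 2 - 2 * (u - m) * (x - m)`, so Hoeffding's
  -- lemma applies.
  have e : ∀ x, Real.exp (-r * ((u - x) ^ 2 - (m - x) ^ 2)) =
      Real.exp (-r * (u - m) ^ 2) * Real.exp (2 * r * (u - m) * (x - m)) := fun x => by
    rw [← Real.exp_add]; congr 1; ring
  simp only [e]
  refine ⟨(hsub.integrable_exp_mul _).const_mul _, ?_⟩
  rw [integral_const_mul]
  have h1 := hsub.mgf_le (2 * r * (u - m))
  rw [mgf] at h1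
  refine (mul_le_mul_of_nonneg_left h1 (Real.exp_pos _).le).trans ?_
  rw [← Real.exp_add, Real.exp_le_exp]
  norm_num
  -- Hoeffding contributes `r ^ 2 / 2 * (u - m) ^ 2`, and `-r + r ^ 2 / 2 ≤ -r / 2` for `r` in `[0,
  -- 1]`.
  nlinarith [mul_nonneg (mul_nonneg hr0 (sub_nonneg.2 hr1)) (sq_nonneg (u - m))]

theorem exp_neg_le_one_sub_half {x : ℝ} (h0 : 0 ≤ x) (h1 : x ≤ 1) :
    Real.exp (-x) ≤ 1 - x / 2 := by
  have h : 1 + x + x ^ 2 / 2 ≤ Real.exp x := Real.quadratic_le_exp_of_nonneg h0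
  rw [Real.exp_neg, inv_le_comm₀ (Real.exp_pos _) (by linarith)]
  refine le_trans ?_ h
  rw [inv_le_iff_one_le_mul₀ (by linarith)]
  nlinarith [mul_nonneg h0 (sub_nonneg.2 h1)]

section Concentration

theorem CMDP.expect_mono {C S A : Type*} [Fintype C] [Fintype S] {H : ℕ} (M : CMDP C S A H)
    {g g' : C → ℝ} (h : ∀ c, g c ≤ g' c) : M.expect g ≤ M.expect g' :=
  Finset.sum_le_sum fun c _ => mul_le_mul_of_nonneg_left (h c) (M.D_mem.1 c)

theorem CMDP.expect_const {C S A : Type*} [Fintype C] [Fintype S] {H : ℕ} (M : CMDP C S A H)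
    (r : ℝ) : M.expect (fun _ => r) = r := by
  rw [CMDP.expect, ← Finset.sum_mul, M.D_mem.2, one_mul]

theorem CMDP.expect_add {C S A : Type*} [Fintype C] [Fintype S] {H : ℕ} (M : CMDP C S A H)
    (g g' : C → ℝ) : M.expect (fun c => g c + g' c) = M.expect g + M.expect g' := by
  simp only [CMDP.expect, mul_add, Finset.sum_add_distrib]

theorem CMDP.expect_mul_left {C S A : Type*} [Fintype C] [Fintype S] {H : ℕ} (M : CMDP C S A H)
    (r : ℝ) (g : C → ℝ) : M.expect (fun c => r * g c) = r * M.expect g := by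
  simp only [CMDP.expect, mul_left_comm _ r, Finset.mul_sum]

theorem CMDP.expect_sum {C S A ι : Type*} [Fintype C] [Fintype S] {H : ℕ} (M : CMDP C S A H)
    (s : Finset ι) (g : ι → C → ℝ) :
    M.expect (fun c => ∑ i ∈ s, g i c) = ∑ i ∈ s, M.expect (g i) := by
  simp only [CMDP.expect, Finset.mul_sum]
  exact Finset.sum_comm

variable {C S A : Type*} [Fintype C] [Fintype S] {H : ℕ}

theorem CMDP.loss_mem_Icc (M : CMDP C S A H) (c : C) (s : S) (a : A) :
    M.loss c s a ∈ Set.Icc (0 : ℝ) 1 := by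
  have := M.isProb c s a
  refine ⟨integral_nonneg_of_ae ?_, ?_⟩
  · filter_upwards [M.loss_mem c s a] with x hx using hx.1
  · have h : ∫ x, x ∂M.lossLaw c s a ≤ ∫ _, (1 : ℝ) ∂M.lossLaw c s a := by
      refine integral_mono_of_nonneg ?_ (integrable_const _) ?_
      · filter_upwards [M.loss_mem c s a] with x hx using hx.1
      · filter_upwards [M.loss_mem c s a] with x hx using hx.2
    simpa [CMDP.loss] using h

/-- The excess squared error of `f` on an episode. -/
noncomputable def CMDP.excess (M : CMDP C S A H) (f : C → S → A → ℝ) (e : Episode C S A H) : ℝ :=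
  ∑ j : Fin H, ((f e.1 (e.2.1 j.castSucc) (e.2.2.1 j) - e.2.2.2 j) ^ 2 -
    (M.loss e.1 (e.2.1 j.castSucc) (e.2.2.1 j) - e.2.2.2 j) ^ 2)

/-- The square root of the likelihood ratio of `P` and the true dynamics on an episode. -/
noncomputable def CMDP.sqrtRatio (M : CMDP C S A H) (P : C → S → A → S → ℝ)
    (e : Episode C S A H) : ℝ :=
  ∏ j : Fin H, √(P e.1 (e.2.1 j.castSucc) (e.2.2.1 j) (e.2.1 j.succ) /
    M.P e.1 (e.2.1 j.castSucc) (e.2.2.1 j) (e.2.1 j.succ))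

/-- Given the path, the losses are independent and the exponential factorizes over the steps. -/
theorem CMDP.lintegral_exp_excess_le (M : CMDP C S A H) (f : C → S → A → ℝ) {r : ℝ} (hr0 : 0 ≤ r)
    (hr1 : r ≤ 1) (c : C) (x : Fin (H + 1) → S) (y : Fin H → A) :
    ∫⁻ l, ENNReal.ofReal (Real.exp (-r * M.excess f (c, x, y, l)))
        ∂(Measure.pi fun i : Fin H => M.lossLaw c (x i.castSucc) (y i)) ≤
      ENNReal.ofReal (Real.exp
        (-(r / 2) * ∑ j : Fin H, (f c (x j.castSucc) (y j) - M.loss c (x j.castSucc) (y j)) ^ 2)) := by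
  have hp := M.isProb
  have h := fun j : Fin H => integrable_exp_excess_and_integral_le
    (M.loss_mem c (x j.castSucc) (y j)) hr0 hr1 (f c (x j.castSucc) (y j))
  have e : ∀ l : Fin H → ℝ, Real.exp (-r * M.excess f (c, x, y, l)) =
      ∏ j : Fin H, Real.exp (-r * ((f c (x j.castSucc) (y j) - l j) ^ 2 -
        ((∫ z, z ∂M.lossLaw c (x j.castSucc) (y j)) - l j) ^ 2)) := fun l => by
    rw [← Real.exp_sum, ← Finset.mul_sum]
    rfl
  simp only [e]
  rw [← ofReal_integral_eq_lintegral_ofReal (Integrable.fintype_prod fun j => (h j).1)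
    (Filter.Eventually.of_forall fun l => Finset.prod_nonneg fun j _ => (Real.exp_pos _).le)]
  refine ENNReal.ofReal_le_ofReal ?_
  rw [integral_fintype_prod_eq_prod (f := fun j l => Real.exp (-r *
    ((f c (x j.castSucc) (y j) - l) ^ 2 -
      ((∫ z, z ∂M.lossLaw c (x j.castSucc) (y j)) - l) ^ 2))), Finset.mul_sum, Real.exp_sum]
  exact Finset.prod_le_prod (fun j _ => integral_nonneg fun l => (Real.exp_pos _).le)
    fun j _ => (h j).2

variable [Fintype A]

/-- The mean squared error of `f` in an episode of the policy `π`. -/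
noncomputable def CMDP.meanSqError (M : CMDP C S A H) (f : C → S → A → ℝ) (π : C → S → A → ℝ) : ℝ :=
  M.expect fun c => value H M.s₁ (M.P c) (fun s a => (f c s a - M.loss c s a) ^ 2) (π c)

/-- Half the mean squared Hellinger distance of the path laws in an episode of the policy `π`. -/
noncomputable def CMDP.meanHellinger (M : CMDP C S A H) (P : C → S → A → S → ℝ)
    (π : C → S → A → ℝ) : ℝ :=
  M.expect fun c => 1 - bhatt H M.s₁ (P c) (M.P c) (π c)

variable [MeasurableSpace C] [DiscreteMeasurableSpace C] [MeasurableSpace S]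
  [DiscreteMeasurableSpace S] [MeasurableSpace A] [DiscreteMeasurableSpace A]

theorem measurable_step {β : Type*} [MeasurableSpace β] (g : C → S → A → S → β) (j : Fin H) :
    Measurable fun e : Episode C S A H =>
      g e.1 (e.2.1 j.castSucc) (e.2.2.1 j) (e.2.1 j.succ) :=
  (Measurable.of_discrete (f := fun z : C × S × A × S => g z.1 z.2.1 z.2.2.1 z.2.2.2)).comp
    (g := fun z : C × S × A × S => g z.1 z.2.1 z.2.2.1 z.2.2.2)
    (f := fun e : Episode C S A H =>
      (e.1, e.2.1 j.castSucc, e.2.2.1 j, e.2.1 j.succ)) (by fun_prop)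

theorem CMDP.measurable_excess (M : CMDP C S A H) (f : C → S → A → ℝ) :
    Measurable (M.excess f) := by
  refine Finset.measurable_sum _ fun j _ => ?_
  have h1 := measurable_step (fun c s a _ => f c s a) j
  have h2 := measurable_step (fun c s a _ => M.loss c s a) j
  fun_prop

theorem CMDP.measurable_sqrtRatio (M : CMDP C S A H) (P : C → S → A → S → ℝ) :
    Measurable (M.sqrtRatio P) :=
  Finset.measurable_prod _ fun j _ =>
    measurable_step (fun c s a s' => √(P c s a s' / M.P c s a s')) j

/-- The squared errors along a path are dependent, so the exponential is linearized before
averaging. The rate `1 / H` keeps the exponent in `[0, 1]`, where `exp (-x) ≤ 1 - x / 2`; this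
halves the constant to `1 / (4 * H)`. -/
theorem CMDP.lintegral_exp_excess_episodeLaw_le (M : CMDP C S A H) (hH : 1 ≤ H)
    {f : C → S → A → ℝ} (hf : ∀ c s a, f c s a ∈ Set.Icc (0 : ℝ) 1) {π : C → S → A → ℝ}
    (hπ : ∀ c s, π c s ∈ stdSimplex ℝ A) :
    ∫⁻ e, ENNReal.ofReal (Real.exp (-(1 / H) * M.excess f e)) ∂M.episodeLaw π ≤
      ENNReal.ofReal (Real.exp (-(1 / (4 * H) * M.meanSqError f π))) := by
  have hH' : (1 : ℝ) ≤ H := by exact_mod_cast hH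
  have hH0 : (0 : ℝ) < H := by linarith
  have hr1 : (1 : ℝ) / H ≤ 1 := (div_le_one hH0).2 hH'
  refine (M.lintegral_episodeLaw_le hπ
    (((M.measurable_excess f).const_mul _).exp.ennreal_ofReal) (fun c x y => (Real.exp_pos _).le)
    fun c x y => M.lintegral_exp_excess_le f (by positivity) hr1 c x y).trans
    (ENNReal.ofReal_le_ofReal ?_)
  refine le_trans ?_ (Real.add_one_le_exp _)
  have h1 : ∀ c, ∑ x : Fin (H + 1) → S, ∑ y : Fin H → A, pathProb M.s₁ (M.P c) (π c) x y *
      Real.exp (-(1 / H / 2) *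
        ∑ j : Fin H, (f c (x j.castSucc) (y j) - M.loss c (x j.castSucc) (y j)) ^ 2) ≤
      1 + -(1 / (4 * H)) *
        value H M.s₁ (M.P c) (fun s a => (f c s a - M.loss c s a) ^ 2) (π c) := by
    intro c
    have e : (1 : ℝ) + -(1 / (4 * H)) *
        value H M.s₁ (M.P c) (fun s a => (f c s a - M.loss c s a) ^ 2) (π c) =
        ∑ x : Fin (H + 1) → S, ∑ y : Fin H → A, pathProb M.s₁ (M.P c) (π c) x y *
          (1 + -(1 / (4 * H)) *
            ∑ j : Fin H, (f c (x j.castSucc) (y j) - M.loss c (x j.castSucc) (y j)) ^ 2) := by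
      simp only [mul_add, mul_one, Finset.sum_add_distrib, sum_pathProb,
        sum_stateLaw (M.isDynamics c).1 (hπ c), value, Finset.mul_sum, mul_left_comm]
    rw [e]
    refine Finset.sum_le_sum fun x _ => Finset.sum_le_sum fun y _ =>
      mul_le_mul_of_nonneg_left ?_ (pathProb_nonneg (fun s a => ((M.isDynamics c).1 s a).1)
        (fun s => (hπ c s).1) x y)
    set Y := ∑ j : Fin H, (f c (x j.castSucc) (y j) - M.loss c (x j.castSucc) (y j)) ^ 2 with hY
    have hY0 : 0 ≤ Y := Finset.sum_nonneg fun j _ => sq_nonneg _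
    have hY1 : Y ≤ H := by
      have : Y ≤ ∑ _j : Fin H, (1 : ℝ) := Finset.sum_le_sum fun j _ => by
        have a1 := hf c (x j.castSucc) (y j)
        have a2 := M.loss_mem_Icc c (x j.castSucc) (y j)
        rw [sq_le_one_iff_abs_le_one, abs_le]
        constructor <;> linarith [a1.1, a1.2, a2.1, a2.2]
      simpa using this
    have h2 := exp_neg_le_one_sub_half (x := 1 / H / 2 * Y) (by positivity) (by
      rw [div_div, one_div_mul_eq_div, div_le_one (by positivity)]; linarith)
    rw [neg_mul]
    refine h2.trans (le_of_eq ?_)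
    field_simp
    ring
  refine (M.expect_mono h1).trans (le_of_eq ?_)
  rw [M.expect_add, M.expect_const, M.expect_mul_left, CMDP.meanSqError]
  ring

/-- Weighting the root of the likelihood ratio by the true path probability gives the geometric mean
of the two path laws. The mean is thus the averaged Bhattacharyya coefficient, and `1 - x ≤ exp
(-x)`. -/
theorem CMDP.lintegral_sqrtRatio_episodeLaw_le (M : CMDP C S A H) (P : C → S → A → S → ℝ)
    {π : C → S → A → ℝ} (hπ : ∀ c s, π c s ∈ stdSimplex ℝ A) :
    ∫⁻ e, ENNReal.ofReal (M.sqrtRatio P e) ∂M.episodeLaw π ≤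
      ENNReal.ofReal (Real.exp (-M.meanHellinger P π)) := by
  have hp := M.isProb
  refine (M.lintegral_episodeLaw_le hπ (M.measurable_sqrtRatio P).ennreal_ofReal
    (g := fun c x y => ∏ j : Fin H, √(P c (x j.castSucc) (y j) (x j.succ) /
      M.P c (x j.castSucc) (y j) (x j.succ)))
    (fun c x y => Finset.prod_nonneg fun j _ => Real.sqrt_nonneg _)
    fun c x y => (le_of_eq (by simp [CMDP.sqrtRatio]))).trans (ENNReal.ofReal_le_ofReal ?_)
  refine le_trans (le_of_eq ?_) (Real.add_one_le_exp _)
  have h1 : ∀ c, ∑ x : Fin (H + 1) → S, ∑ y : Fin H → A, pathProb M.s₁ (M.P c) (π c) x y *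
      ∏ j : Fin H, √(P c (x j.castSucc) (y j) (x j.succ) /
        M.P c (x j.castSucc) (y j) (x j.succ)) =
      1 + -1 * (1 - bhatt H M.s₁ (P c) (M.P c) (π c)) := by
    intro c
    rw [bhatt, ← sum_pathProb]
    ring_nf
    refine Finset.sum_congr rfl fun x _ => Finset.sum_congr rfl fun y _ => ?_
    rw [pathProb, pathProb, mul_assoc, ← Finset.prod_mul_distrib]
    congr 1
    refine Finset.prod_congr rfl fun j _ => ?_
    rw [mul_assoc, geomKernel]
    congr 1
    have h0 := ((M.isDynamics c).1 (x j.castSucc) (y j)).1 (x j.succ)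
    rcases h0.eq_or_lt with h | h
    · simp [← h]
    · rw [← Real.sqrt_sq h.le, ← Real.sqrt_mul (sq_nonneg _), Real.sqrt_sq h.le]
      congr 1
      field_simp
  simp only [h1]
  rw [M.expect_add, M.expect_const, M.expect_mul_left, CMDP.meanHellinger]
  ring

theorem CMDP.episodeLaw_vanishing_transition (M : CMDP C S A H) (π : C → S → A → ℝ)
    (j : Fin H) :
    M.episodeLaw π {e | M.P e.1 (e.2.1 j.castSucc) (e.2.2.1 j) (e.2.1 j.succ) = 0} = 0 := by
  classical
  have hp := M.isProb
  have hE : MeasurableSet {e : Episode C S A H |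
      M.P e.1 (e.2.1 j.castSucc) (e.2.2.1 j) (e.2.1 j.succ) = 0} :=
    measurable_step (fun c s a s' => M.P c s a s') j (measurableSet_singleton 0)
  rw [← lintegral_indicator_one hE, M.lintegral_episodeLaw π (measurable_one.indicator hE)]
  refine Finset.sum_eq_zero fun c _ => Finset.sum_eq_zero fun x _ => Finset.sum_eq_zero fun y _ => ?_
  by_cases h : M.P c (x j.castSucc) (y j) (x j.succ) = 0
  · rw [pathProb, Finset.prod_eq_zero (Finset.mem_univ j) (by rw [h, mul_zero])]
    simp
  · simp [Set.indicator, h]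

end Concentration

/-! ### Optimality of the estimates on the data and the union bound -/

theorem ENNReal.sum_log_eq_log_prod {ι : Type*} (s : Finset ι) (f : ι → ENNReal) :
    ∑ i ∈ s, ENNReal.log (f i) = ENNReal.log (∏ i ∈ s, f i) := by
  classical
  induction s using Finset.induction_on with
  | empty => simp
  | insert a s ha ih => rw [Finset.sum_insert ha, Finset.prod_insert ha, ENNReal.log_mul_add, ih]

/-- A likelihood at least that of the truth makes the ratio at least 1. The condition `hd` excludes
a vanishing denominator, for which the ratio would be 0 by convention. -/
theorem CMDP.one_le_prod_sqrtRatio {C S A : Type*} [Fintype C] [Fintype S] {H t : ℕ}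
    (M : CMDP C S A H) {P : C → S → A → S → ℝ} (hP : ∀ c s a s', 0 ≤ P c s a s')
    {d : Fin t → Episode C S A H} (h : logLik M.P d ≤ logLik P d)
    (hd : ∀ i j, M.P (d i).1 ((d i).2.1 j.castSucc) ((d i).2.2.1 j) ((d i).2.1 j.succ) ≠ 0) :
    1 ≤ ∏ i, M.sqrtRatio P (d i) := by
  have h0 : ∀ c s a s', 0 ≤ M.P c s a s' := fun c s a => ((M.isDynamics c).1 s a).1
  simp only [logLik, ENNReal.sum_log_eq_log_prod, ENNReal.log_le_log_iff] at h
  simp only [← ENNReal.ofReal_prod_of_nonneg fun j _ => h0 _ _ _ _,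
    ← ENNReal.ofReal_prod_of_nonneg fun j _ => hP _ _ _ _] at h
  rw [← ENNReal.ofReal_prod_of_nonneg fun i _ => Finset.prod_nonneg fun j _ => h0 _ _ _ _,
    ← ENNReal.ofReal_prod_of_nonneg fun i _ => Finset.prod_nonneg fun j _ => hP _ _ _ _,
    ENNReal.ofReal_le_ofReal_iff (Finset.prod_nonneg fun i _ => Finset.prod_nonneg fun j _ =>
      hP _ _ _ _)] at h
  simp only [CMDP.sqrtRatio, ← Real.sqrt_prod _ fun j _ => div_nonneg (hP _ _ _ _) (h0 _ _ _ _)]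
  rw [← Real.sqrt_prod _ fun i _ => Finset.prod_nonneg fun j _ =>
    div_nonneg (hP _ _ _ _) (h0 _ _ _ _), Real.one_le_sqrt]
  simp only [Finset.prod_div_distrib]
  rwa [one_le_div]
  exact Finset.prod_pos fun i _ => Finset.prod_pos fun j _ =>
    lt_of_le_of_ne (h0 _ _ _ _) (hd i j).symm

theorem CMDP.sum_excess_nonpos {C S A : Type*} [Fintype C] [Fintype S] {H t : ℕ}
    (M : CMDP C S A H) {f : C → S → A → ℝ} {d : Fin t → Episode C S A H}
    (h : sqError f d ≤ sqError M.loss d) : ∑ i, M.excess f (d i) ≤ 0 := by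
  simp only [CMDP.excess, Finset.sum_sub_distrib]
  exact sub_nonpos.2 h

theorem measure_biUnion_biUnion_le {Ω ι : Type*} [MeasurableSpace Ω] (μ : Measure Ω) {T : ℕ}
    (hT : 1 ≤ T) {s : Finset ι} (hs : s.Nonempty) {B : ℕ → ι → Set Ω} {δ : ℝ}
    (h : ∀ t < T, ∀ i ∈ s, μ (B t i) ≤ ENNReal.ofReal (δ / (T * s.card))) :
    μ (⋃ t ∈ Finset.range T, ⋃ i ∈ s, B t i) ≤ ENNReal.ofReal δ := by
  have hT' : (0 : ℝ) < T := by exact_mod_cast hT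
  have hs' : (0 : ℝ) < s.card := by exact_mod_cast hs.card_pos
  calc μ (⋃ t ∈ Finset.range T, ⋃ i ∈ s, B t i)
      ≤ ∑ t ∈ Finset.range T, ∑ i ∈ s, ENNReal.ofReal (δ / (T * s.card)) :=
        (measure_biUnion_finset_le _ _).trans (Finset.sum_le_sum fun t ht =>
          (measure_biUnion_finset_le _ _).trans (Finset.sum_le_sum fun i hi =>
            h t (Finset.mem_range.1 ht) i hi))
    _ = ENNReal.ofReal δ := by
        simp only [Finset.sum_const, Finset.card_range, nsmul_eq_mul]
        rw [← ENNReal.ofReal_natCast, ← ENNReal.ofReal_natCast, ← ENNReal.ofReal_mul (by positivity),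
          ← ENNReal.ofReal_mul (by positivity)]
        congr 1
        field_simp

/-! ### Generalization bounds along the run -/

section HighProbability

variable {C S A Ω : Type*}
    [Fintype C] [MeasurableSpace C] [DiscreteMeasurableSpace C]
    [Fintype S] [MeasurableSpace S] [DiscreteMeasurableSpace S]
    [Fintype A] [MeasurableSpace A] [DiscreteMeasurableSpace A] [Nonempty A]
    {H T : ℕ} {M : CMDP C S A H} {𝓕 : Finset (C → S → A → ℝ)} {𝓟 : Finset (C → S → A → S → ℝ)}
    {G : Learner C S A H} [MeasurableSpace Ω] {μ : Measure Ω} [IsProbabilityMeasure μ]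
    {σ : ℕ → Ω → Episode C S A H}

/-- Generalization bound for the least squares estimates on the past policies. -/
theorem IsRun.measure_exists_meanSqError_gt_le (hrun : IsRun μ M G T σ) (hH : 1 ≤ H) (hT : 1 ≤ T)
    (h𝓕 : ∀ f ∈ 𝓕, ∀ c s a, f c s a ∈ Set.Icc (0 : ℝ) 1) (hreal : M.loss ∈ 𝓕)
    (hf : IsLeastSquaresOracle 𝓕 G.fOracle) (hp : IsLogLossOracle 𝓟 G.pOracle)
    {δ : ℝ} (hδ : 0 < δ) :
    μ {ω | ∃ t < T, 4 * H * Real.log (T * 𝓕.card / δ) <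
      ∑ i ∈ Finset.range t, M.meanSqError (fHat G (fun k => σ k ω) t)
        (pol M G (fun k => σ k ω) i)} ≤ ENNReal.ofReal δ := by
  have hT' : (0 : ℝ) < T := by exact_mod_cast hT
  have hH' : (0 : ℝ) < H := by exact_mod_cast hH
  have hs : 𝓕.Nonempty := ⟨_, hreal⟩
  have hs' : (0 : ℝ) < 𝓕.card := by exact_mod_cast hs.card_pos
  -- The estimate depends on the data, so the deviation bound is applied to every fixed `f` and
  -- round, each at level `δ / (T * 𝓕.card)`.
  refine le_trans (measure_mono ?_) (measure_biUnion_biUnion_le μ hT hs (δ := δ) fun t ht f hfm =>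
    hrun.measure_le_prod_mul_exp_le hf hp ((M.measurable_excess f).const_mul (-(1 / H : ℝ))).exp
      (fun e => (Real.exp_pos _).le) (fun π => 1 / (4 * H) * M.meanSqError f π)
      (fun π hπ => M.lintegral_exp_excess_episodeLaw_le hH (h𝓕 f hfm) hπ) (n := t) ht.le
      (by positivity))
  rintro ω ⟨t, ht, h⟩
  simp only [Set.mem_iUnion, Finset.mem_range]
  refine ⟨t, ht, fHat G (fun k => σ k ω) t, hf.mem _ _, ?_⟩
  have h1 : ∑ i ∈ Finset.range t, M.excess (fHat G (fun k => σ k ω) t) (σ i ω) ≤ 0 := by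
    rw [Finset.sum_range]
    exact M.sum_excess_nonpos (hf.isMin t _ _ hreal)
  rw [Set.mem_ofPred_eq, ← Real.exp_sum, ← Finset.mul_sum, ← Finset.mul_sum, one_div_div]
  refine le_trans ?_ (le_mul_of_one_le_left (Real.exp_pos _).le
    (Real.one_le_exp (mul_nonneg_of_nonpos_of_nonpos (by simp) h1)))
  rw [← Real.log_le_iff_le_exp (by positivity), one_div_mul_eq_div, le_div_iff₀ (by positivity)]
  linarith

/-- Generalization bound in Hellinger distance for the maximum likelihood estimates on the past
policies. -/
theorem IsRun.measure_exists_meanHellinger_gt_le (hrun : IsRun μ M G T σ) (hT : 1 ≤ T)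
    (h𝓟 : ∀ P ∈ 𝓟, ∀ c, M.toLayering.IsDynamics (P c)) (hreal : M.P ∈ 𝓟)
    (hf : IsLeastSquaresOracle 𝓕 G.fOracle) (hp : IsLogLossOracle 𝓟 G.pOracle)
    {δ : ℝ} (hδ : 0 < δ) :
    μ {ω | ∃ t < T, Real.log (T * 𝓟.card / δ) <
      ∑ i ∈ Finset.range t, M.meanHellinger (pHat G (fun k => σ k ω) t)
        (pol M G (fun k => σ k ω) i)} ≤ ENNReal.ofReal δ := by
  have hT' : (0 : ℝ) < T := by exact_mod_cast hT
  have hs : 𝓟.Nonempty := ⟨_, hreal⟩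
  have hs' : (0 : ℝ) < 𝓟.card := by exact_mod_cast hs.card_pos
  -- Almost surely no observed transition has true probability 0, as needed to compare likelihoods
  -- by their ratio.
  have hnull : μ (⋃ t ∈ Finset.range T, ⋃ j : Fin H, {ω | M.P (σ t ω).1
      ((σ t ω).2.1 j.castSucc) ((σ t ω).2.2.1 j) ((σ t ω).2.1 j.succ) = 0}) = 0 := by
    simp only [measure_iUnion_null_iff, Finset.mem_range]
    intro t ht j
    have := hrun.condLaw t ht Set.univ MeasurableSet.univ
      {e | M.P e.1 (e.2.1 j.castSucc) (e.2.2.1 j) (e.2.1 j.succ) = 0}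
      (measurable_step (fun c s a s' => M.P c s a s') j (measurableSet_singleton 0))
    simpa [M.episodeLaw_vanishing_transition] using this
  refine le_trans (measure_mono (t := _ ∪ _) ?_) ((measure_union_le _ _).trans
    ((add_le_add hnull.le (measure_biUnion_biUnion_le μ hT hs (δ := δ) fun t ht P hP =>
    hrun.measure_le_prod_mul_exp_le hf hp (M.measurable_sqrtRatio P)
      (fun e => Finset.prod_nonneg fun j _ => Real.sqrt_nonneg _) (M.meanHellinger P)
      (fun π hπ => M.lintegral_sqrtRatio_episodeLaw_le P hπ) (n := t) ht.le
      (by positivity))).trans (zero_add _).le))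
  rintro ω ⟨t, ht, h⟩
  refine or_iff_not_imp_left.2 fun hω => ?_
  simp only [Set.mem_iUnion, Finset.mem_range, not_exists, Set.mem_ofPred_eq] at hω ⊢
  refine ⟨t, ht, pHat G (fun k => σ k ω) t, hp.mem _ _, ?_⟩
  have h1 : 1 ≤ ∏ i ∈ Finset.range t, M.sqrtRatio (pHat G (fun k => σ k ω) t) (σ i ω) := by
    rw [Finset.prod_range]
    exact M.one_le_prod_sqrtRatio (fun c s a => ((h𝓟 _ (hp.mem _ _) c).1 s a).1)
      (hp.isMax t _ _ hreal) fun i j => hω i (i.2.trans ht) j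
  rw [one_div_div]
  refine le_trans ?_ (le_mul_of_one_le_left (Real.exp_pos _).le h1)
  exact (Real.log_le_iff_le_exp (by positivity)).1 h.le

end HighProbability

/-! ### The gap of one round, averaged over contexts -/

theorem evalQ_nonneg {S A : Type*} [Fintype S] [Fintype A] (Phat : S → A → S → ℝ)
    (lhat : S → A → ℝ) (π : S → A → ℝ) (n : ℕ) (s : S) (a : A) : 0 ≤ evalQ Phat lhat π n s a := by
  cases n with
  | zero => exact le_rfl
  | succ n => exact le_max_left _ _

section Regret

variable {C S A : Type*} [Fintype C] [Fintype S] [Fintype A] [Nonempty A] {H : ℕ}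

/-- True values are at most `H` and truncated estimates are nonnegative. This pays for the first
round, whose bonuses do not enter the final bound. -/
theorem CMDP.expect_value_sub_vHat_le_horizon (M : CMDP C S A H) (G : Learner C S A H)
    (ep : ℕ → Episode C S A H) (t : ℕ) :
    M.expect (fun c => value H M.s₁ (M.P c) (M.loss c) (pol M G ep t c) - vHat M G ep t c) ≤ H := by
  rw [← M.expect_const (H : ℝ)]
  refine M.expect_mono fun c => ?_
  have h1 := value_mono (s₁ := M.s₁) (H := H) (M.isDynamics c).1 (pol_mem_stdSimplex M G ep t c)
    fun s a => (M.loss_mem_Icc c s a).2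
  rw [value_const (M.isDynamics c).1 (pol_mem_stdSimplex M G ep t c), mul_one] at h1
  have h2 : 0 ≤ vHat M G ep t c := Finset.sum_nonneg fun a _ =>
    mul_nonneg ((pol_mem_stdSimplex M G ep t c M.s₁).1 a) (evalQ_nonneg _ _ _ _ _ _)
  linarith

theorem CMDP.expect_value_sub_vHat_le (M : CMDP C S A H) (G : Learner C S A H)
    (hβℓ : 0 < G.βℓ) (hβP : 0 < G.βP) (ep : ℕ → Episode C S A H) (t : ℕ)
    (hfh : ∀ c s a, fHat G ep t c s a ∈ Set.Icc (0 : ℝ) 1)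
    (hPh : ∀ c, M.toLayering.IsDynamics (pHat G ep t c)) :
    M.expect (fun c => value H M.s₁ (M.P c) (M.loss c) (pol M G ep t c) - vHat M G ep t c) ≤
      2 * M.expect (fun c => ∑ h ∈ Finset.Icc 1 H, ∑ s with M.layer s = h, ∑ a,
          occ H M.s₁ (M.P c) (pol M G ep t c) h s a *
            (bonusAt M G ep G.βℓ t c s a + 2 * H * bonusAt M G ep G.βP t c s a)) +
        1 / (2 * G.βℓ) * (H +
          2 * ∑ i ∈ Finset.range t, M.meanSqError (fHat G ep t) (pol M G ep i) +
          4 * H * ∑ i ∈ Finset.range t, M.meanHellinger (pHat G ep t) (pol M G ep i)) +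
        H / G.βP * (H +
          8 * H * ∑ i ∈ Finset.range t, M.meanHellinger (pHat G ep t) (pol M G ep i)) := by
  refine (M.expect_mono fun c => value_sub_optimistic_le M.toLayering hβℓ hβP (M.isDynamics c)
    (hPh c) (pol_mem_stdSimplex M G ep t c) (fun i => pol_mem_stdSimplex M G ep i c)
    (M.loss_mem_Icc c) (hfh c)).trans (le_of_eq ?_)
  simp only [M.expect_add, M.expect_mul_left, M.expect_const, M.expect_sum, Finset.sum_range,
    CMDP.meanSqError, CMDP.meanHellinger,
    ← value_eq_sum_occ M.toLayering (M.isDynamics _) (pol_mem_stdSimplex M G ep t _)]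
  rfl

end Regret

/-! ### Constants and assembly of the final bound -/

theorem log_terms_le {T H F P : ℕ} (hT : 1 ≤ T) (hH : 1 ≤ H) (hF : 1 ≤ F) (hP : 1 ≤ P) {δ : ℝ}
    (hδ : δ ∈ Set.Ioo (0 : ℝ) 1) :
    Real.log (T * F / (δ / 8)) ≤ Real.log (128 * T ^ 4 * H * F * P / δ ^ 2) ∧
    Real.log (T * P / (δ / 8)) ≤ Real.log (128 * T ^ 4 * H * F * P / δ ^ 2) ∧
    Real.log (T * P / (δ / 8)) ≤ Real.log (8 * T * H * P / δ) ∧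
    1 ≤ Real.log (T * P / (δ / 8)) := by
  obtain ⟨h0, h1⟩ := hδ
  have hT' : (1 : ℝ) ≤ T := by exact_mod_cast hT
  have hH' : (1 : ℝ) ≤ H := by exact_mod_cast hH
  have hF' : (1 : ℝ) ≤ F := by exact_mod_cast hF
  have hP' : (1 : ℝ) ≤ P := by exact_mod_cast hP
  have key : ∀ X Y : ℝ, 1 ≤ X → 1 ≤ Y →
      T * X / (δ / 8) ≤ 128 * T ^ 4 * H * X * Y / δ ^ 2 := fun X Y hX hY => by
    rw [div_le_div_iff₀ (by positivity) (by positivity)]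
    have e1 : (1 : ℝ) ≤ T ^ 3 := one_le_pow₀ hT'
    have e2 : (1 : ℝ) ≤ T ^ 3 * H * Y :=
      one_le_mul_of_one_le_of_one_le (one_le_mul_of_one_le_of_one_le e1 hH') hY
    have e3 : δ ≤ 16 * (T ^ 3 * H * Y) := by linarith
    have e4 : 0 ≤ T * X * δ := by positivity
    nlinarith [mul_le_mul_of_nonneg_left e3 e4]
  refine ⟨Real.log_le_log (by positivity) (key F P hF' hP'), Real.log_le_log (by positivity) ?_,
    Real.log_le_log (by positivity) ?_, ?_⟩
  · have := key P F hP' hF'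
    rwa [mul_right_comm _ (P : ℝ) (F : ℝ)] at this
  · rw [div_div_eq_mul_div]
    refine div_le_div_of_nonneg_right ?_ h0.le
    nlinarith [mul_le_mul_of_nonneg_left hH' (show (0 : ℝ) ≤ T * P by positivity)]
  -- The argument of the logarithm is at least 8, which exceeds `e`. This lets the additive terms
  -- `H` and `H ^ 2` be absorbed into logarithmic ones.
  · rw [Real.le_log_iff_exp_le (by positivity), le_div_iff₀ (by positivity)]
    have := Real.exp_one_lt_d9
    have : (1 : ℝ) ≤ T * P := one_le_mul_of_one_le_of_one_le hT' hP'
    nlinarith [Real.exp_pos 1]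

theorem lemma1 {C S A Ω : Type*}
    [Fintype C] [MeasurableSpace C] [DiscreteMeasurableSpace C]
    [Fintype S] [MeasurableSpace S] [DiscreteMeasurableSpace S]
    [Fintype A] [MeasurableSpace A] [DiscreteMeasurableSpace A] [Nonempty A]
    {H T : ℕ} (hH : 1 ≤ H) (hT : 1 ≤ T)
    -- the contextual MDP and the finite realizable function classes
    (M : CMDP C S A H)
    (𝓕 : Finset (C → S → A → ℝ)) (h𝓕 : ∀ f ∈ 𝓕, ∀ c s a, f c s a ∈ Set.Icc (0 : ℝ) 1)
    (hreal𝓕 : M.loss ∈ 𝓕)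
    (𝓟 : Finset (C → S → A → S → ℝ)) (h𝓟 : ∀ P ∈ 𝓟, ∀ c, M.toLayering.IsDynamics (P c))
    (hreal𝓟 : M.P ∈ 𝓟)
    -- the algorithm
    (G : Learner C S A H) (hβℓ : 0 < G.βℓ) (hβP : 0 < G.βP)
    (hf : IsLeastSquaresOracle 𝓕 G.fOracle) (hp : IsLogLossOracle 𝓟 G.pOracle)
    -- its execution for `T` rounds
    [MeasurableSpace Ω] (μ : Measure Ω) [IsProbabilityMeasure μ]
    (σ : ℕ → Ω → Episode C S A H) (hrun : IsRun μ M G T σ)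
    (δ : ℝ) (hδ : δ ∈ Set.Ioo (0 : ℝ) 1) :
    ENNReal.ofReal (1 - δ / 4) ≤ μ {ω |
      let ep : ℕ → Episode C S A H := fun k => σ k ω
      ∑ t ∈ Finset.range T, M.expect (fun c =>
          value H M.s₁ (M.P c) (M.loss c) (pol M G ep t c) - vHat M G ep t c)
        ≤ H
          + 112 * T * H ^ 3 * Real.log (128 * T ^ 4 * H * 𝓕.card * 𝓟.card / δ ^ 2) / G.βℓ
          + 25 * T * H ^ 4 * Real.log (8 * T * H * 𝓟.card / δ) / G.βP
          + 2 * M.expect (fun c =>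
              ∑ t ∈ Finset.Ico 1 T, ∑ h ∈ Finset.Icc 1 H, ∑ s with M.layer s = h, ∑ a,
                occ H M.s₁ (M.P c) (pol M G ep t c) h s a *
                  (bonusAt M G ep G.βℓ t c s a + 2 * H * bonusAt M G ep G.βP t c s a))} := by
  classical
  have hH' : (1 : ℝ) ≤ H := by exact_mod_cast hH
  have hT' : (1 : ℝ) ≤ T := by exact_mod_cast hT
  -- The failure probability `δ / 4` is split evenly between the two oracles.
  have hδ8 : 0 < δ / 8 := by linarith [hδ.1]
  have hbad := (measure_union_le _ _).trans
    (add_le_add (hrun.measure_exists_meanSqError_gt_le hH hT h𝓕 hreal𝓕 hf hp hδ8)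
      (hrun.measure_exists_meanHellinger_gt_le hT h𝓟 hreal𝓟 hf hp hδ8))
  rw [← ENNReal.ofReal_add hδ8.le hδ8.le] at hbad
  set bad : Set Ω := _ ∪ _ with hbad_def
  have hcompl : ENNReal.ofReal (1 - δ / 4) ≤ μ badᶜ := by
    have h1 : 1 ≤ μ badᶜ + μ bad := by
      rw [← measure_univ (μ := μ), ← Set.compl_union_self bad]
      exact measure_union_le _ _
    rw [ENNReal.ofReal_sub _ (by linarith [hδ.1]), ENNReal.ofReal_one, tsub_le_iff_right]
    refine h1.trans (add_le_add_right (hbad.trans (le_of_eq ?_)) _)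
    congr 1
    ring
  refine hcompl.trans (measure_mono fun ω hω => ?_)
  simp only [hbad_def, Set.mem_compl_iff, Set.mem_union, Set.mem_ofPred_eq, not_or, not_exists,
    not_and, not_lt] at hω
  obtain ⟨hω1, hω2⟩ := hω
  simp only [Set.mem_ofPred_eq]
  set ep : ℕ → Episode C S A H := fun k => σ k ω
  obtain ⟨l1, l2, l3, l4⟩ := log_terms_le hT hH (Finset.card_pos.2 ⟨_, hreal𝓕⟩)
    (Finset.card_pos.2 ⟨_, hreal𝓟⟩) hδ
  set L₁ := Real.log (128 * T ^ 4 * H * 𝓕.card * 𝓟.card / δ ^ 2)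
  set L₂ := Real.log (8 * T * H * 𝓟.card / δ)
  have hround : ∀ t ∈ Finset.Ico 1 T,
      M.expect (fun c => value H M.s₁ (M.P c) (M.loss c) (pol M G ep t c) - vHat M G ep t c) ≤
      2 * M.expect (fun c => ∑ h ∈ Finset.Icc 1 H, ∑ s with M.layer s = h, ∑ a,
          occ H M.s₁ (M.P c) (pol M G ep t c) h s a *
            (bonusAt M G ep G.βℓ t c s a + 2 * H * bonusAt M G ep G.βP t c s a)) +
        (112 * H ^ 3 * L₁ / G.βℓ + 25 * H ^ 4 * L₂ / G.βP) := by
    intro t ht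
    have ht' := (Finset.mem_Ico.1 ht).2
    refine (M.expect_value_sub_vHat_le G hβℓ hβP ep t (h𝓕 _ (hf.mem _ _))
      (h𝓟 _ (hp.mem _ _))).trans ?_
    rw [add_assoc]
    have h1 := hω1 t ht'
    have h2 := hω2 t ht'
    refine add_le_add_right (add_le_add ?_ ?_) _
    -- The bracket is at most `H + 8 * H * L₁ + 4 * H * L₁ ≤ 13 * H * L₁`, well within `224 * H ^ 3
    -- * L₁`.
    · rw [one_div_mul_eq_div, div_le_div_iff₀ (by positivity) hβℓ, mul_left_comm, ← mul_assoc]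
      refine mul_le_mul_of_nonneg_right ?_ hβℓ.le
      have hpow : H * L₁ ≤ H ^ 3 * L₁ :=
        mul_le_mul_of_nonneg_right (le_self_pow₀ hH' (by norm_num)) (by linarith)
      nlinarith [mul_le_mul_of_nonneg_left (h2.trans l2) (zero_le_one.trans hH'),
        mul_le_mul_of_nonneg_left l1 (zero_le_one.trans hH')]
    -- Here the numerator is at most `H ^ 2 + 8 * H ^ 2 * L₂ ≤ 9 * H ^ 2 * L₂`.
    · rw [div_mul_eq_mul_div]
      refine div_le_div_of_nonneg_right ?_ hβP.le
      have hpow : (H : ℝ) ^ 2 * L₂ ≤ H ^ 4 * L₂ :=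
        mul_le_mul_of_nonneg_right (pow_le_pow_right₀ hH' (by norm_num)) (by linarith)
      nlinarith [mul_le_mul_of_nonneg_left (h2.trans l3) (sq_nonneg (H : ℝ)),
        mul_le_mul_of_nonneg_left (l4.trans l3) (sq_nonneg (H : ℝ))]
  rw [Finset.range_eq_Ico, Finset.sum_eq_sum_Ico_succ_bot (by omega)]
  have h0 := M.expect_value_sub_vHat_le_horizon G ep 0
  have h1 := Finset.sum_le_sum hround
  rw [Finset.sum_add_distrib, Finset.sum_const, Nat.card_Ico, ← Finset.mul_sum,
    nsmul_eq_mul, Nat.cast_sub hT] at h1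
  have hK : 0 ≤ 112 * H ^ 3 * L₁ / G.βℓ + 25 * H ^ 4 * L₂ / G.βP := by
    have : 0 ≤ L₁ := by linarith
    have : 0 ≤ L₂ := by linarith
    positivity
  have e1 : 112 * T * H ^ 3 * L₁ / G.βℓ + 25 * T * H ^ 4 * L₂ / G.βP =
      T * (112 * H ^ 3 * L₁ / G.βℓ + 25 * H ^ 4 * L₂ / G.βP) := by ring
  push_cast at h1
  rw [add_assoc (H : ℝ), e1, M.expect_sum]
  simp only [zero_add]
  linarith
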